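/- Let $n\ge 1$ be an integer and let $\mathbb R^{2n}$, with coordinates $(x_1,y_1,\dots,x_n,y_n)$, carry the standard symplectic form $\omega_{\mathrm{std}}=\sum_{j=1}^n dx_j\wedge dy_j$. A symplectic embedding of an open set $U\subset\mathbb R^{2n}$ into an open set $V\subset\mathbb R^{2n}$ is a smooth map $\iota\colon U\to V$ that is a diffeomorphism onto its image (an open subset of $V$) and satisfies $\iota^*\omega_{\mathrm{std}}=\omega_{\mathrm{std}}$. Let $\Sigma\subset\mathbb R^{2n}$ be the union of the integer coordinate hyperplanes, that is, the set of points having at least one integer coordinate. Theorem. Let $k\ge 5$ be an odd integer. Then there exist $\alpha>0$ and a symplectic embedding $$\iota\colon (0,\alpha)\times(0,1)^{2n-1}\hookrightarrow (0,k)^{2n}$$ such that (i) the image of $\iota$ contains $\big((2,k-2)\times(0,k)^{2n-1}\big)\setminus\Sigma$; (ii) $\alpha\ge 1$, and the restriction of $\iota$ to $(0,1)\times(0,1)^{2n-1}$ is the identity, $\iota(z)=z$; (iii) the restriction of $\iota$ to $(\alpha-1,\alpha)\times(0,1)^{2n-1}$ is the translation $\iota(z)=z+(k-\alpha,\,k-1,\,\dots,\,k-1)$.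 -/

import Mathlib

open scoped ContDiff

/-- The space `ℝ²ⁿ` with coordinates `(x₁, y₁, …, xₙ, yₙ)`: the coordinate with index `(j, 0)`
is the `x` coordinate of the `j`-th plane and the one with index `(j, 1)` is its `y` coordinate.
The index `(0, 0)` is that of the first coordinate. -/
abbrev SymplSpace (n : ℕ) : Type := Fin n × Fin 2 → ℝ

/-- The standard symplectic form `∑ⱼ dxⱼ ∧ dyⱼ` of `ℝ²ⁿ`. -/
def stdSymplForm {n : ℕ} (v w : SymplSpace n) : ℝ :=
  ∑ j : Fin n, (v (j, 0) * w (j, 1) - v (j, 1) * w (j, 0))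

/-- `f` restricts to a symplectic embedding of the open set `U ⊆ ℝ²ⁿ` into the open set `V ⊆ ℝ²ⁿ`:
a diffeomorphism of `U` onto its (open) image, which lies in `V`, and which pulls the standard
symplectic form back to itself. The values of `f` outside `U` are irrelevant. -/
structure IsSymplEmbedding {n : ℕ} (f : SymplSpace n → SymplSpace n) (U V : Set (SymplSpace n)) :
    Prop where
  isOpen_source : IsOpen U
  isOpen_target : IsOpen V
  mapsTo : Set.MapsTo f U V
  injOn : Set.InjOn f U
  contDiffOn : ContDiffOn ℝ ∞ f U
  isOpen_image : IsOpen (f '' U)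
  contDiffOn_inv : ContDiffOn ℝ ∞ (Function.invFunOn f U) (f '' U)
  pullback : ∀ z ∈ U, ∀ v w : SymplSpace n,
    stdSymplForm (fderiv ℝ f z v) (fderiv ℝ f z w) = stdSymplForm v w

/-- The set `I × J²ⁿ⁻¹ ⊆ ℝ²ⁿ`. -/
def box (n : ℕ) [NeZero n] (I J : Set ℝ) : Set (SymplSpace n) :=
  {z | z (0, 0) ∈ I ∧ ∀ p : Fin n × Fin 2, p ≠ (0, 0) → z p ∈ J}

/-- The cube `(0, a)²ⁿ`. -/
def symplCube (n : ℕ) (a : ℝ) : Set (SymplSpace n) :=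
  {z | ∀ p : Fin n × Fin 2, z p ∈ Set.Ioo 0 a}

/-- The union of the integer coordinate hyperplanes of `ℝ²ⁿ`: the points that have at least one
integer coordinate. -/
def integerHyperplanes (n : ℕ) : Set (SymplSpace n) :=
  {z | ∃ p : Fin n × Fin 2, ∃ m : ℤ, z p = m}

/-- The vector `(a, b, …, b)` of `ℝ²ⁿ`. -/
def shiftVector (n : ℕ) [NeZero n] (a b : ℝ) : SymplSpace n :=
  fun p => if p = (0, 0) then a else b

open Filter Topology

section PullsBack

variable {E F G : Type*} [NormedAddCommGroup E] [NormedSpace ℝ E] [NormedAddCommGroup F]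
  [NormedSpace ℝ F] [NormedAddCommGroup G] [NormedSpace ℝ G]

/-- `f` is smooth at `x` and its derivative at `x` pulls the form `η` back to `c • τ`. -/
def PullsBackAt (τ : E → E → ℝ) (η : F → F → ℝ) (c : ℝ) (f : E → F) (x : E) : Prop :=
  ContDiffAt ℝ ∞ f x ∧ ∀ v w, η (fderiv ℝ f x v) (fderiv ℝ f x w) = c * τ v w

theorem PullsBackAt.contDiffAt {τ : E → E → ℝ} {η : F → F → ℝ} {c : ℝ} {f : E → F} {x : E}
    (h : PullsBackAt τ η c f x) : ContDiffAt ℝ ∞ f x := h.1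

theorem PullsBackAt.differentiableAt {τ : E → E → ℝ} {η : F → F → ℝ} {c : ℝ} {f : E → F} {x : E}
    (h : PullsBackAt τ η c f x) : DifferentiableAt ℝ f x :=
  h.1.differentiableAt (by simp)

theorem PullsBackAt.comp {τ : E → E → ℝ} {η : F → F → ℝ} {θ : G → G → ℝ} {c d : ℝ}
    {g : F → G} {f : E → F} {x : E} (hg : PullsBackAt η θ d g (f x)) (hf : PullsBackAt τ η c f x) :
    PullsBackAt τ θ (d * c) (g ∘ f) x := by
  refine ⟨hg.1.comp x hf.1, fun v w => ?_⟩
  rw [fderiv_comp x hg.differentiableAt hf.differentiableAt]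
  simp [hg.2, hf.2, mul_assoc]

theorem PullsBackAt.congr {τ : E → E → ℝ} {η : F → F → ℝ} {c : ℝ} {f g : E → F} {x : E}
    (h : PullsBackAt τ η c f x) (hfg : g =ᶠ[𝓝 x] f) : PullsBackAt τ η c g x := by
  refine ⟨h.1.congr_of_eventuallyEq hfg, fun v w => ?_⟩
  rw [hfg.fderiv_eq]
  exact h.2 v w

theorem PullsBackAt.of_hasFDerivAt {τ : E → E → ℝ} {η : F → F → ℝ} {c : ℝ} {f : E → F} {x : E}
    {f' : E →L[ℝ] F} (hf : ContDiffAt ℝ ∞ f x) (hf' : HasFDerivAt f f' x)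
    (h : ∀ v w, η (f' v) (f' w) = c * τ v w) : PullsBackAt τ η c f x :=
  ⟨hf, by rw [hf'.fderiv]; exact h⟩

end PullsBack

section Form

variable {n : ℕ}

/-- The index of the coordinate conjugate to the one with index `q`. -/
def conjIdx (q : Fin n × Fin 2) : Fin n × Fin 2 := (q.1, 1 - q.2)

/-- The sign of the coordinate with index `q` in the symplectic form. -/
def idxSign (q : Fin n × Fin 2) : ℝ := if q.2 = 0 then 1 else -1

theorem conjIdx_ne {p q : Fin n × Fin 2} (h : p.1 ≠ q.1) : conjIdx p ≠ q :=
  fun e => h (e ▸ rfl)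

theorem stdSymplForm_swap (v w : SymplSpace n) : stdSymplForm v w = -stdSymplForm w v := by
  simp only [stdSymplForm, ← Finset.sum_neg_distrib]
  exact Finset.sum_congr rfl fun j _ => by ring

theorem stdSymplForm_add_left (u v w : SymplSpace n) :
    stdSymplForm (u + v) w = stdSymplForm u w + stdSymplForm v w := by
  simp only [stdSymplForm, ← Finset.sum_add_distrib, Pi.add_apply]
  exact Finset.sum_congr rfl fun j _ => by ring

theorem stdSymplForm_smul_left (a : ℝ) (v w : SymplSpace n) :
    stdSymplForm (a • v) w = a * stdSymplForm v w := by
  simp only [stdSymplForm, Finset.mul_sum, Pi.smul_apply, smul_eq_mul]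
  exact Finset.sum_congr rfl fun j _ => by ring

theorem stdSymplForm_add_right (u v w : SymplSpace n) :
    stdSymplForm u (v + w) = stdSymplForm u v + stdSymplForm u w := by
  rw [stdSymplForm_swap, stdSymplForm_add_left, stdSymplForm_swap v, stdSymplForm_swap w]; ring

theorem stdSymplForm_smul_right (a : ℝ) (v w : SymplSpace n) :
    stdSymplForm v (a • w) = a * stdSymplForm v w := by
  rw [stdSymplForm_swap, stdSymplForm_smul_left, stdSymplForm_swap w]; ring

theorem stdSymplForm_single_left (q : Fin n × Fin 2) (w : SymplSpace n) :
    stdSymplForm (Pi.single q 1) w = idxSign q * w (conjIdx q) := by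
  obtain ⟨i, c⟩ := q
  rw [stdSymplForm, Finset.sum_eq_single i]
  · fin_cases c <;> simp [idxSign, conjIdx]
  · intro j _ hj
    simp [hj]
  · simp

theorem stdSymplForm_single_right (q : Fin n × Fin 2) (w : SymplSpace n) :
    stdSymplForm w (Pi.single q 1) = -(idxSign q * w (conjIdx q)) := by
  rw [stdSymplForm_swap, stdSymplForm_single_left]

theorem stdSymplForm_nondegenerate {v : SymplSpace n} (h : ∀ w, stdSymplForm v w = 0) : v = 0 := by
  funext q
  have h1 := h (Pi.single (conjIdx q) 1)
  rw [stdSymplForm_single_right] at h1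
  obtain ⟨i, c⟩ := q
  fin_cases c <;> simpa [idxSign, conjIdx] using h1

end Form

/-- `f` is smooth and symplectic at `z`. -/
abbrev SymplAt {n : ℕ} (f : SymplSpace n → SymplSpace n) (z : SymplSpace n) : Prop :=
  PullsBackAt stdSymplForm stdSymplForm 1 f z

theorem SymplAt.comp' {n : ℕ} {f g : SymplSpace n → SymplSpace n} {z : SymplSpace n}
    (hg : SymplAt g (f z)) (hf : SymplAt f z) : SymplAt (g ∘ f) z := by
  simpa using PullsBackAt.comp hg hf

theorem SymplAt.exists_equiv {n : ℕ} {f : SymplSpace n → SymplSpace n} {z : SymplSpace n}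
    (h : SymplAt f z) :
    ∃ e : SymplSpace n ≃L[ℝ] SymplSpace n, (e : SymplSpace n →L[ℝ] SymplSpace n) = fderiv ℝ f z := by
  have hinj : Function.Injective (fderiv ℝ f z : SymplSpace n →ₗ[ℝ] SymplSpace n) := by
    rw [← LinearMap.ker_eq_bot, LinearMap.ker_eq_bot']
    intro v hv
    refine stdSymplForm_nondegenerate fun w => ?_
    have h1 := h.2 v w
    have h2 : fderiv ℝ f z v = 0 := hv
    rw [h2, one_mul] at h1
    rw [← h1, stdSymplForm]
    simp
  refine ⟨(LinearEquiv.ofInjectiveEndo _ hinj).toContinuousLinearEquiv, ?_⟩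
  ext v
  rfl

/-- An injective map that is smooth and symplectic at every point of an open set is a symplectic
embedding of this set. -/
theorem IsSymplEmbedding.of_symplAt {n : ℕ} {f : SymplSpace n → SymplSpace n}
    {U V : Set (SymplSpace n)} (hU : IsOpen U) (hV : IsOpen V) (hUV : Set.MapsTo f U V)
    (hinj : Set.InjOn f U) (hf : ∀ z ∈ U, SymplAt f z) : IsSymplEmbedding f U V := by
  have key : ∀ z ∈ U, f '' U ∈ 𝓝 (f z) ∧ ContDiffAt ℝ ∞ (Function.invFunOn f U) (f z) := by
    intro z hz
    obtain ⟨e, he⟩ := (hf z hz).exists_equiv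
    have hd : HasFDerivAt f (e : SymplSpace n →L[ℝ] SymplSpace n) z := by
      rw [he]; exact (hf z hz).differentiableAt.hasFDerivAt
    have hc := (hf z hz).contDiffAt
    have hs := hc.hasStrictFDerivAt' hd (by simp)
    have hmap := hs.map_nhds_eq_of_equiv
    have him : f '' U ∈ 𝓝 (f z) := by
      rw [← hmap]
      exact image_mem_map (hU.mem_nhds hz)
    refine ⟨him, (hc.to_localInverse hd (by simp)).congr_of_eventuallyEq ?_⟩
    have hcont : Tendsto (hc.localInverse hd (by simp)) (𝓝 (f z)) (𝓝 z) := by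
      have := (hc.to_localInverse hd (by simp)).continuousAt
      rw [ContinuousAt, hc.localInverse_apply_image] at this
      exact this
    have hright : ∀ᶠ y in 𝓝 (f z), f (hc.localInverse hd (by simp) y) = y :=
      hs.eventually_right_inverse
    filter_upwards [hcont (hU.mem_nhds hz), hright, him] with y h1 h2 h3
    refine hinj (Function.invFunOn_mem h3) h1 ?_
    rw [Function.invFunOn_eq h3, h2]
  refine ⟨hU, hV, hUV, hinj, fun z hz => (hf z hz).contDiffAt.contDiffWithinAt, ?_, ?_, ?_⟩
  · rw [isOpen_iff_mem_nhds]
    rintro _ ⟨z, hz, rfl⟩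
    exact (key z hz).1
  · rintro _ ⟨z, hz, rfl⟩
    exact (key z hz).2.contDiffWithinAt
  · intro z hz v w
    simpa using (hf z hz).2 v w

section Plane

/-- The standard area form of the plane. -/
def areaForm (v w : ℝ × ℝ) : ℝ := v.1 * w.2 - v.2 * w.1

/-- `f` is smooth at `u` and its Jacobian determinant at `u` is `c`. -/
abbrev AreaAt (c : ℝ) (f : ℝ × ℝ → ℝ × ℝ) (u : ℝ × ℝ) : Prop :=
  PullsBackAt areaForm areaForm c f u

theorem AreaAt.of_partial {f g : ℝ × ℝ → ℝ} {u : ℝ × ℝ} {f₁ f₂ g₁ g₂ c : ℝ}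
    (hfc : ContDiffAt ℝ ∞ f u) (hgc : ContDiffAt ℝ ∞ g u)
    (hf : HasFDerivAt f (f₁ • ContinuousLinearMap.fst ℝ ℝ ℝ + f₂ • ContinuousLinearMap.snd ℝ ℝ ℝ) u)
    (hg : HasFDerivAt g (g₁ • ContinuousLinearMap.fst ℝ ℝ ℝ + g₂ • ContinuousLinearMap.snd ℝ ℝ ℝ) u)
    (hc : f₁ * g₂ - f₂ * g₁ = c) : AreaAt c (fun u => (f u, g u)) u := by
  refine .of_hasFDerivAt (hfc.prodMk hgc) (hf.prodMk hg) fun v w => ?_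
  simp only [areaForm, ContinuousLinearMap.prod_apply, add_apply, smul_apply,
    ContinuousLinearMap.coe_fst', ContinuousLinearMap.coe_snd', smul_eq_mul]
  rw [← hc]; ring

/-- The shear `(x, y) ↦ (x, y + h x)`. -/
def vShear (h : ℝ → ℝ) (u : ℝ × ℝ) : ℝ × ℝ := (u.1, u.2 + h u.1)

/-- The shear `(x, y) ↦ (x + h y, y)`. -/
def hShear (h : ℝ → ℝ) (u : ℝ × ℝ) : ℝ × ℝ := (u.1 + h u.2, u.2)

theorem vShear_injective (h : ℝ → ℝ) : Function.Injective (vShear h) := by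
  rintro ⟨a, b⟩ ⟨c, d⟩ e
  simp only [vShear, Prod.mk.injEq] at e ⊢
  obtain ⟨rfl, e⟩ := e
  exact ⟨rfl, by linarith⟩

theorem hShear_injective (h : ℝ → ℝ) : Function.Injective (hShear h) := by
  rintro ⟨a, b⟩ ⟨c, d⟩ e
  simp only [hShear, Prod.mk.injEq] at e ⊢
  obtain ⟨e, rfl⟩ := e
  exact ⟨by linarith, rfl⟩

theorem areaAt_vShear {h : ℝ → ℝ} (hh : ContDiff ℝ ∞ h) (u : ℝ × ℝ) : AreaAt 1 (vShear h) u := by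
  have h1 : HasDerivAt h (deriv h u.1) u.1 := (hh.differentiable (by simp) _).hasDerivAt
  refine AreaAt.of_partial (f₁ := 1) (f₂ := 0) (g₁ := deriv h u.1) (g₂ := 1) (by fun_prop)
    (by fun_prop) ?_ ?_ (by ring)
  · simpa using hasFDerivAt_fst
  · have := (hasFDerivAt_snd (𝕜 := ℝ) (E := ℝ) (F := ℝ) (p := u)).add
      (h1.comp_hasFDerivAt u hasFDerivAt_fst)
    rw [one_smul, add_comm]
    exact this

theorem areaAt_hShear {h : ℝ → ℝ} (hh : ContDiff ℝ ∞ h) (u : ℝ × ℝ) : AreaAt 1 (hShear h) u := by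
  have h1 : HasDerivAt h (deriv h u.2) u.2 := (hh.differentiable (by simp) _).hasDerivAt
  refine AreaAt.of_partial (f₁ := 1) (f₂ := deriv h u.2) (g₁ := 0) (g₂ := 1) (by fun_prop)
    (by fun_prop) ?_ ?_ (by ring)
  · have := (hasFDerivAt_fst (𝕜 := ℝ) (E := ℝ) (F := ℝ) (p := u)).add
      (h1.comp_hasFDerivAt u hasFDerivAt_snd)
    rw [one_smul]
    exact this
  · simpa using hasFDerivAt_snd

/-- The map `(s, v) ↦ (X s, c + (v - c) / X' s)`. -/
noncomputable def stretch (X : ℝ → ℝ) (c : ℝ) (u : ℝ × ℝ) : ℝ × ℝ :=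
  (X u.1, c + (u.2 - c) * (deriv X u.1)⁻¹)

theorem areaAt_stretch {X : ℝ → ℝ} (hX : ContDiff ℝ ∞ X) (c : ℝ) {u : ℝ × ℝ}
    (hu : deriv X u.1 ≠ 0) : AreaAt 1 (stretch X c) u := by
  have h1 : HasDerivAt X (deriv X u.1) u.1 := (hX.differentiable (by simp) _).hasDerivAt
  have hX' : ContDiff ℝ ∞ (deriv X) := (contDiff_infty_iff_deriv.1 hX).2
  have hinv : ContDiffAt ℝ ∞ (fun s => (deriv X s)⁻¹) u.1 := hX'.contDiffAt.inv hu
  have h2 := (hinv.differentiableAt (by simp)).hasDerivAt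
  refine AreaAt.of_partial (f₁ := deriv X u.1) (f₂ := 0)
    (g₁ := (u.2 - c) * deriv (fun s => (deriv X s)⁻¹) u.1) (g₂ := (deriv X u.1)⁻¹) (by fun_prop)
    ?_ ?_ ?_ ?_
  · exact contDiffAt_const.add ((contDiffAt_snd.sub contDiffAt_const).mul
      (hinv.comp u contDiffAt_fst))
  · rw [zero_smul, add_zero]
    exact h1.comp_hasFDerivAt u hasFDerivAt_fst
  · have h3 := ((hasFDerivAt_snd (𝕜 := ℝ) (E := ℝ) (F := ℝ) (p := u)).sub_const c).mul
      (h2.comp_hasFDerivAt u hasFDerivAt_fst)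
    have h4 := h3.const_add c
    rw [smul_smul] at h4
    exact h4
  · rw [mul_inv_cancel₀ hu]; ring

/-- The reflection `(x, y) ↦ (x, c - y)`. -/
def flipSnd (c : ℝ) (u : ℝ × ℝ) : ℝ × ℝ := (u.1, c - u.2)

/-- The reflection `(x, y) ↦ (c - x, y)`. -/
def flipFst (c : ℝ) (u : ℝ × ℝ) : ℝ × ℝ := (c - u.1, u.2)

@[simp] theorem flipSnd_flipSnd (c : ℝ) (u : ℝ × ℝ) : flipSnd c (flipSnd c u) = u := by
  simp [flipSnd]

theorem areaAt_flipSnd (c : ℝ) (u : ℝ × ℝ) : AreaAt (-1) (flipSnd c) u := by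
  refine AreaAt.of_partial (f₁ := 1) (f₂ := 0) (g₁ := 0) (g₂ := -1) (by fun_prop)
    (by fun_prop) ?_ ?_ (by ring)
  · simpa using hasFDerivAt_fst
  · exact (hasFDerivAt_snd.const_sub c).congr_fderiv (by ext <;> simp)

theorem areaAt_flipFst (c : ℝ) (u : ℝ × ℝ) : AreaAt (-1) (flipFst c) u := by
  refine AreaAt.of_partial (f₁ := -1) (f₂ := 0) (g₁ := 0) (g₂ := 1) (by fun_prop)
    (by fun_prop) ?_ ?_ (by ring)
  · exact (hasFDerivAt_fst.const_sub c).congr_fderiv (by ext <;> simp)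
  · simpa using hasFDerivAt_snd

end Plane

section Lift

variable {n : ℕ} [NeZero n]

/-- The map of `ℝ²ⁿ` that acts by `φ` on the first plane and fixes the other coordinates. -/
def planeLift (φ : ℝ × ℝ → ℝ × ℝ) (z : SymplSpace n) : SymplSpace n := fun q =>
  if q = (0, 0) then (φ (z (0, 0), z (0, 1))).1
  else if q = (0, 1) then (φ (z (0, 0), z (0, 1))).2 else z q

@[simp] theorem planeLift_fst (φ : ℝ × ℝ → ℝ × ℝ) (z : SymplSpace n) :
    planeLift φ z (0, 0) = (φ (z (0, 0), z (0, 1))).1 := by simp [planeLift]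

@[simp] theorem planeLift_snd (φ : ℝ × ℝ → ℝ × ℝ) (z : SymplSpace n) :
    planeLift φ z (0, 1) = (φ (z (0, 0), z (0, 1))).2 := by simp [planeLift]

theorem planeLift_of_ne (φ : ℝ × ℝ → ℝ × ℝ) (z : SymplSpace n) {q : Fin n × Fin 2}
    (h0 : q ≠ (0, 0)) (h1 : q ≠ (0, 1)) : planeLift φ z q = z q := by simp [planeLift, h0, h1]

theorem symplAt_planeLift {φ : ℝ × ℝ → ℝ × ℝ} {z : SymplSpace n}
    (h : AreaAt 1 φ (z (0, 0), z (0, 1))) : SymplAt (planeLift φ) z := by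
  have hcoord : ∀ q : Fin n × Fin 2, HasFDerivAt (fun z : SymplSpace n => z q)
      (ContinuousLinearMap.proj q : SymplSpace n →L[ℝ] ℝ) z := fun q => hasFDerivAt_apply q z
  have hpc : ContDiffAt ℝ ∞ (fun z : SymplSpace n => (z (0, 0), z (0, 1))) z := by fun_prop
  have hφc : ContDiffAt ℝ ∞ (fun z : SymplSpace n => φ (z (0, 0), z (0, 1))) z :=
    h.contDiffAt.comp z hpc
  have hφ : HasFDerivAt (fun z : SymplSpace n => φ (z (0, 0), z (0, 1))) _ z :=
    h.differentiableAt.hasFDerivAt.comp z ((hcoord (0, 0)).prodMk (hcoord (0, 1)))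
  set D := fderiv ℝ φ (z (0, 0), z (0, 1)) with hD
  let L : SymplSpace n →L[ℝ] ℝ × ℝ := D.comp
    ((ContinuousLinearMap.proj (0, 0) : SymplSpace n →L[ℝ] ℝ).prod
      (ContinuousLinearMap.proj (0, 1)))
  let M : SymplSpace n →L[ℝ] SymplSpace n := ContinuousLinearMap.pi fun q =>
    if q = (0, 0) then (ContinuousLinearMap.fst ℝ ℝ ℝ).comp L
    else if q = (0, 1) then (ContinuousLinearMap.snd ℝ ℝ ℝ).comp L
    else ContinuousLinearMap.proj q
  have hM : HasFDerivAt (planeLift φ) M z := by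
    rw [hasFDerivAt_pi']
    intro q
    by_cases h0 : q = (0, 0)
    · subst h0
      simpa [planeLift, M] using hφ.fst
    · by_cases h1 : q = (0, 1)
      · subst h1
        simpa [planeLift, M] using hφ.snd
      · simpa [planeLift, M, h0, h1] using hcoord q
  have hc : ContDiffAt ℝ ∞ (planeLift φ) z := by
    rw [contDiffAt_pi]
    intro q
    by_cases h0 : q = (0, 0)
    · subst h0
      simpa [planeLift] using hφc.fst
    · by_cases h1 : q = (0, 1)
      · subst h1
        simpa [planeLift] using hφc.snd
      · simp only [planeLift, h0, h1, if_false]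
        fun_prop
  refine .of_hasFDerivAt hc hM fun v w => ?_
  rw [one_mul]
  refine Finset.sum_congr rfl fun j _ => ?_
  by_cases hj : j = 0
  · subst hj
    have := h.2 (v (0, 0), v (0, 1)) (w (0, 0), w (0, 1))
    simpa [areaForm, M, L, hD] using this
  · simp [M, hj]

/-- The time-one map of the Hamiltonian flow that moves the coordinate with index `p` by
`σ * b (x₁)` and compensates for it in the coordinate `y₁`. -/
noncomputable def foldShear (b : ℝ → ℝ) (p : Fin n × Fin 2) (σ c : ℝ) (z : SymplSpace n) :
    SymplSpace n :=
  z - (deriv b (z (0, 0)) * (σ * idxSign p * z (conjIdx p) + c)) • Pi.single (0, 1) (1 : ℝ)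
    + (σ * b (z (0, 0))) • Pi.single p (1 : ℝ)

theorem symplAt_foldShear {b : ℝ → ℝ} (hb : ContDiff ℝ ∞ b) {p : Fin n × Fin 2} (hp : p.1 ≠ 0)
    (σ c : ℝ) (z : SymplSpace n) : SymplAt (foldShear b p σ c) z := by
  have hb' : ContDiff ℝ ∞ (deriv b) := (contDiff_infty_iff_deriv.1 hb).2
  have h1 : HasDerivAt b (deriv b (z (0, 0))) (z (0, 0)) :=
    (hb.differentiable (by simp) _).hasDerivAt
  have h2 : HasDerivAt (deriv b) (deriv (deriv b) (z (0, 0))) (z (0, 0)) :=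
    (hb'.differentiable (by simp) _).hasDerivAt
  have hcoord : ∀ q : Fin n × Fin 2, HasFDerivAt (fun z : SymplSpace n => z q)
      (ContinuousLinearMap.proj q : SymplSpace n →L[ℝ] ℝ) z := fun q => hasFDerivAt_apply q z
  obtain ⟨D, hD, hDv⟩ : ∃ D : SymplSpace n →L[ℝ] SymplSpace n,
      HasFDerivAt (foldShear b p σ c) D z ∧ ∀ v, D v = v
        + (-(deriv b (z (0, 0)) * (σ * idxSign p * v (conjIdx p)) +
          deriv (deriv b) (z (0, 0)) * v (0, 0) * (σ * idxSign p * z (conjIdx p) + c))) •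
            (Pi.single (0, 1) (1 : ℝ) : SymplSpace n)
        + (σ * (deriv b (z (0, 0)) * v (0, 0))) • (Pi.single p (1 : ℝ) : SymplSpace n) := by
    refine ⟨_, ((hasFDerivAt_id z).sub (((h2.comp_hasFDerivAt z (hcoord (0, 0))).mul
    (((hcoord (conjIdx p)).const_mul (σ * idxSign p)).add_const c)).smul_const
      (Pi.single (0, 1) (1 : ℝ) : SymplSpace n))).add
    (((h1.comp_hasFDerivAt z (hcoord (0, 0))).const_mul σ).smul_const
      (Pi.single p (1 : ℝ) : SymplSpace n)), fun v => ?_⟩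
    ext q
    simp
    ring
  have e2 : conjIdx ((0, 1) : Fin n × Fin 2) = (0, 0) := rfl
  have e3 : (Pi.single p (1 : ℝ) : SymplSpace n) (0, 0) = 0 := by
    rw [Pi.single_apply, if_neg]; rintro rfl; exact hp rfl
  have e4 : (Pi.single (0, 1) (1 : ℝ) : SymplSpace n) (0, 0) = 0 := by simp
  have e5 : (Pi.single p (1 : ℝ) : SymplSpace n) (conjIdx p) = 0 := by
    obtain ⟨j, c⟩ := p
    fin_cases c <;> simp [conjIdx]
  have e8 : (Pi.single (0, 1) (1 : ℝ) : SymplSpace n) (conjIdx p) = 0 := by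
    rw [Pi.single_apply, if_neg]; intro h; exact hp (congrArg Prod.fst h)
  have e6 : idxSign ((0, 1) : Fin n × Fin 2) = -1 := by simp [idxSign]
  refine .of_hasFDerivAt ?_ hD fun v w => ?_
  · unfold foldShear
    fun_prop
  · rw [hDv, hDv]
    simp only [stdSymplForm_add_left,
      stdSymplForm_add_right, stdSymplForm_smul_left, stdSymplForm_smul_right,
      stdSymplForm_single_left, stdSymplForm_single_right, e2, e3, e4, e5, e6, e8, Pi.add_apply,
      Pi.smul_apply, smul_eq_mul]
    ring

end Lift

section UTurn

/-- A smooth function that vanishes on `(-∞, 0]` and is the identity on `[1/1000, ∞)`. -/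
noncomputable def kink (t : ℝ) : ℝ := t * Real.smoothTransition (1000 * t)

theorem kink_of_nonpos {t : ℝ} (h : t ≤ 0) : kink t = 0 := by
  rw [kink, Real.smoothTransition.zero_of_nonpos (by linarith), mul_zero]

theorem kink_of_ge {t : ℝ} (h : 1 / 1000 ≤ t) : kink t = t := by
  rw [kink, Real.smoothTransition.one_of_one_le (by linarith), mul_one]

theorem contDiff_kink : ContDiff ℝ ∞ kink :=
  contDiff_id.mul (Real.smoothTransition.contDiff.comp (contDiff_const.mul contDiff_id))

theorem kink_nonneg (t : ℝ) : 0 ≤ kink t := by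
  rcases le_total t 0 with h | h
  · rw [kink_of_nonpos h]
  · exact mul_nonneg h (Real.smoothTransition.nonneg _)

theorem kink_le (t : ℝ) : kink t ≤ max t 0 := by
  rcases le_total t 0 with h | h
  · rw [kink_of_nonpos h]; exact le_max_right _ _
  · exact (mul_le_of_le_one_right h (Real.smoothTransition.le_one _)).trans (le_max_left _ _)

theorem monotone_kink : Monotone kink := by
  intro s t h
  rcases le_total s 0 with hs | hs
  · rw [kink_of_nonpos hs]; exact kink_nonneg t
  · exact mul_le_mul h (Real.smoothTransition.monotone (by linarith))
      (Real.smoothTransition.nonneg _) (hs.trans h)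

/-- A smooth diffeomorphism of `ℝ` that is the identity near `(-∞, 0]` and has slope `100` on
`[1/500, ∞)`. -/
noncomputable def runX (s : ℝ) : ℝ := s + 99 * kink (s - 1 / 1000)

theorem runX_of_le {s : ℝ} (h : s ≤ 1 / 1000) : runX s = s := by
  rw [runX, kink_of_nonpos (by linarith)]; ring

theorem runX_of_ge {s : ℝ} (h : 2 / 1000 ≤ s) : runX s = 100 * s - 99 / 1000 := by
  rw [runX, kink_of_ge (by linarith)]; ring

theorem contDiff_runX : ContDiff ℝ ∞ runX :=
  contDiff_id.add (contDiff_const.mul (contDiff_kink.comp (contDiff_id.sub contDiff_const)))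

theorem strictMono_runX : StrictMono runX := by
  intro s t h
  have := monotone_kink (show s - 1 / 1000 ≤ t - 1 / 1000 by linarith)
  simp only [runX]; linarith

theorem one_le_deriv_runX (s : ℝ) : 1 ≤ deriv runX s := by
  have hk : Monotone fun s => 99 * kink (s - 1 / 1000) := fun s t h => by
    have := monotone_kink (show s - 1 / 1000 ≤ t - 1 / 1000 by linarith)
    simp only; linarith
  have hd : Differentiable ℝ fun s => 99 * kink (s - 1 / 1000) :=
    (contDiff_const.mul (contDiff_kink.comp (contDiff_id.sub contDiff_const))).differentiable
      (n := ∞) (by simp)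
  have : deriv runX s = 1 + deriv (fun s => 99 * kink (s - 1 / 1000)) s :=
    ((hasDerivAt_id s).add (hd s).hasDerivAt).deriv
  rw [this]
  linarith [hk.deriv_nonneg (x := s)]

theorem deriv_runX_of_lt {s : ℝ} (h : s < 1 / 1000) : deriv runX s = 1 := by
  have : runX =ᶠ[𝓝 s] id := by
    filter_upwards [Iio_mem_nhds h] with t ht
    exact runX_of_le (le_of_lt ht)
  rw [this.deriv_eq, deriv_id]

theorem deriv_runX_of_gt {s : ℝ} (h : 2 / 1000 < s) : deriv runX s = 100 := by
  have : runX =ᶠ[𝓝 s] fun s => 100 * s - 99 / 1000 := by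
    filter_upwards [Ioi_mem_nhds h] with t ht
    exact runX_of_ge (le_of_lt ht)
  rw [this.deriv_eq]
  simp

/-- The map that squeezes the strip `ℝ × (0, 1)` to height `1/100` on `[1/500, ∞)`. -/
noncomputable def narrow : ℝ × ℝ → ℝ × ℝ := stretch runX (2 / 5)

theorem areaAt_narrow (u : ℝ × ℝ) : AreaAt 1 narrow u :=
  areaAt_stretch contDiff_runX _ (by linarith [one_le_deriv_runX u.1])

theorem narrow_injective : Function.Injective narrow := by
  rintro ⟨a, b⟩ ⟨c, d⟩ e
  simp only [narrow, stretch, Prod.mk.injEq] at e ⊢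
  obtain ⟨e1, e2⟩ := e
  obtain rfl := strictMono_runX.injective e1
  have h : 0 < (deriv runX a)⁻¹ := inv_pos.2 (by linarith [one_le_deriv_runX a])
  refine ⟨rfl, ?_⟩
  have := mul_right_cancel₀ h.ne' (add_left_cancel e2)
  linarith

theorem narrow_of_lt {u : ℝ × ℝ} (h : u.1 < 1 / 1000) : narrow u = u := by
  ext
  · simp [narrow, stretch, runX_of_le h.le]
  · simp [narrow, stretch, deriv_runX_of_lt h]

theorem narrow_of_gt {u : ℝ × ℝ} (h : 2 / 1000 < u.1) :
    narrow u = (100 * u.1 - 99 / 1000, 2 / 5 + (u.2 - 2 / 5) / 100) := by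
  ext
  · simp [narrow, stretch, runX_of_ge h.le]
  · simp [narrow, stretch, deriv_runX_of_gt h, div_eq_mul_inv]

theorem narrow_snd_mem {u : ℝ × ℝ} (h0 : 0 < u.2) (h1 : u.2 < 1) :
    0 < (narrow u).2 ∧ (narrow u).2 < 1 := by
  have h := one_le_deriv_runX u.1
  have hp : 0 < (deriv runX u.1)⁻¹ := inv_pos.2 (by linarith)
  have hl : (deriv runX u.1)⁻¹ ≤ 1 := inv_le_one_of_one_le₀ h
  simp only [narrow, stretch]
  constructor <;> nlinarith

/-- A composition of three shears that turns a thin horizontal strip upwards. -/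
noncomputable def corner : ℝ × ℝ → ℝ × ℝ :=
  vShear (fun x => kink (x - 19 / 10)) ∘ hShear (fun y => -kink (y - 21 / 50)) ∘
    vShear (fun x => kink (x - 19 / 10))

theorem areaAt_corner (u : ℝ × ℝ) : AreaAt 1 corner u := by
  have h1 : ContDiff ℝ ∞ fun x => kink (x - 19 / 10) :=
    contDiff_kink.comp (contDiff_id.sub contDiff_const)
  have h2 : ContDiff ℝ ∞ fun y => -kink (y - 21 / 50) :=
    (contDiff_kink.comp (contDiff_id.sub contDiff_const)).neg
  have := (areaAt_vShear h1 _).comp ((areaAt_hShear h2 _).comp (areaAt_vShear h1 u))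
  rwa [one_mul, one_mul] at this

theorem corner_injective : Function.Injective corner :=
  (vShear_injective _).comp ((hShear_injective _).comp (vShear_injective _))

theorem corner_of_le {u : ℝ × ℝ} (h1 : u.1 ≤ 19 / 10) (h2 : u.2 ≤ 21 / 50) : corner u = u := by
  have e1 : kink (u.1 - 19 / 10) = 0 := kink_of_nonpos (by linarith)
  have e2 : kink (u.2 - 21 / 50) = 0 := kink_of_nonpos (by linarith)
  simp [corner, vShear, hShear, e1, e2]

theorem corner_bounds {u : ℝ × ℝ} (h1 : 19 / 10 ≤ u.1) (h2 : u.2 ≤ 21 / 50) :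
    19 / 10 ≤ (corner u).1 ∧ (corner u).1 ≤ u.1 ∧ u.2 ≤ (corner u).2 ∧
      (corner u).2 ≤ u.2 + 2 * (u.1 - 19 / 10) := by
  obtain ⟨x, y⟩ := u
  simp only at h1 h2
  simp only [corner, vShear, hShear, Function.comp_apply]
  have a0 := kink_nonneg (x - 19 / 10)
  have a1 := kink_le (x - 19 / 10)
  rw [max_eq_left (by linarith)] at a1
  set k := kink (x - 19 / 10)
  have b0 := kink_nonneg (y + k - 21 / 50)
  have b1 := kink_le (y + k - 21 / 50)
  have b2 : max (y + k - 21 / 50) 0 ≤ k := max_le (by linarith) a0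
  set l := kink (y + k - 21 / 50)
  have c0 := kink_nonneg (x + -l - 19 / 10)
  have c1 := kink_le (x + -l - 19 / 10)
  rw [max_eq_left (by linarith)] at c1
  refine ⟨?_, ?_, ?_, ?_⟩ <;> linarith

theorem corner_of_ge {u : ℝ × ℝ} (h1 : 97 / 50 ≤ u.1) (h2 : 394 / 1000 ≤ u.2)
    (h3 : u.2 ≤ 41 / 100) : corner u = (58 / 25 - u.2, u.1 - 37 / 25) := by
  obtain ⟨x, y⟩ := u
  simp only at h1 h2 h3
  have e1 : kink (x - 19 / 10) = x - 19 / 10 := kink_of_ge (by linarith)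
  have e2 : kink (y + (x - 19 / 10) - 21 / 50) = y + (x - 19 / 10) - 21 / 50 :=
    kink_of_ge (by linarith)
  have e3 : kink (x + -(y + (x - 19 / 10) - 21 / 50) - 19 / 10) =
      x + -(y + (x - 19 / 10) - 21 / 50) - 19 / 10 := kink_of_ge (by linarith)
  simp only [corner, vShear, hShear, Function.comp_apply, e1, e2, e3, Prod.mk.injEq]
  constructor <;> ring

/-- The first half of a U-turn: the strip is squeezed, runs to the right and turns upwards. -/
noncomputable def halfTurn (u : ℝ × ℝ) : ℝ × ℝ :=
  if u.1 < 3 / 1000 then narrow u else corner (narrow u)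

/-- The domain of `halfTurn`: the strip `ℝ × (0, 1)`, with room added below where it runs to the
right. -/
def halfStrip : Set (ℝ × ℝ) :=
  {u | -31 < u.2 ∧ u.2 < 1 ∧ (0 < u.2 ∨ 3 / 1000 ≤ u.1 ∧ u.1 ≤ 199 / 10000)}

theorem halfTurn_of_lt {u : ℝ × ℝ} (h : u.1 < 1 / 1000) : halfTurn u = u := by
  rw [halfTurn, if_pos (by linarith), narrow_of_lt h]

theorem halfTurn_of_le {u : ℝ × ℝ} (h1 : u.1 ≤ 1999 / 100000) (h2 : u.2 < 1) :
    halfTurn u = narrow u := by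
  rw [halfTurn]
  split_ifs with h
  · rfl
  · have e := narrow_of_gt (u := u) (by linarith)
    refine corner_of_le ?_ ?_ <;> rw [e] <;> simp only <;> linarith

theorem halfTurn_of_ge {u : ℝ × ℝ} (h1 : 2039 / 100000 ≤ u.1) (h2 : 0 < u.2) (h3 : u.2 < 1) :
    halfTurn u = (58 / 25 - (2 / 5 + (u.2 - 2 / 5) / 100), 100 * u.1 - 1579 / 1000) := by
  have e := narrow_of_gt (u := u) (by linarith)
  rw [halfTurn, if_neg (by linarith), e, corner_of_ge] <;> simp only
  · ext <;> simp only
    ring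
  all_goals linarith

theorem areaAt_halfTurn {u : ℝ × ℝ} (hu : u ∈ halfStrip) : AreaAt 1 halfTurn u := by
  obtain ⟨-, h1, -⟩ := hu
  rcases lt_or_ge u.1 (4 / 1000) with h | h
  · refine (areaAt_narrow u).congr ?_
    filter_upwards [(isOpen_Iio.preimage continuous_fst).mem_nhds h,
      (isOpen_Iio.preimage continuous_snd).mem_nhds h1] with w hw1 hw2
    simp only [Set.mem_preimage, Set.mem_Iio] at hw1 hw2
    exact halfTurn_of_le (by linarith) hw2
  · have := (areaAt_corner (narrow u)).comp (areaAt_narrow u)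
    rw [one_mul] at this
    refine this.congr ?_
    have h' : (3 : ℝ) / 1000 < u.1 := by linarith
    filter_upwards [(isOpen_Ioi.preimage continuous_fst).mem_nhds h'] with w hw
    simp only [Set.mem_preimage, Set.mem_Ioi] at hw
    rw [halfTurn, if_neg (by linarith), Function.comp_apply]

theorem halfTurn_bounds_of_le {u : ℝ × ℝ} (hu : u ∈ halfStrip) (h : u.1 ≤ 2 / 1000) :
    (halfTurn u).1 = runX u.1 ∧ (halfTurn u).1 ≤ 101 / 1000 ∧ 0 < (halfTurn u).2 ∧
      (halfTurn u).2 < 1 := by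
  obtain ⟨-, h1, h2⟩ := hu
  have h0 : 0 < u.2 := by
    rcases h2 with h2 | h2
    · exact h2
    · linarith [h2.1]
  rw [halfTurn_of_le (by linarith) h1]
  refine ⟨rfl, ?_, narrow_snd_mem h0 h1⟩
  have := strictMono_runX.monotone h
  rw [runX_of_ge le_rfl] at this
  change runX u.1 ≤ _
  linarith

theorem halfTurn_bounds_of_gt {u : ℝ × ℝ} (hu : u ∈ halfStrip) {Y : ℝ} (hY : 1 ≤ Y)
    (h : 2 / 1000 < u.1) :
    101 / 1000 < (halfTurn u).1 ∧ (halfTurn u).1 < 2 ∧ 0 < (halfTurn u).2 ∧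
      (u.1 < (1579 / 1000 + Y / 2) / 100 → (halfTurn u).2 < Y / 2) := by
  obtain ⟨h0, h1, h2⟩ := hu
  have e := narrow_of_gt h
  rcases le_or_gt u.1 (1999 / 100000) with h3 | h3
  · rw [halfTurn_of_le h3 h1, e]
    refine ⟨?_, ?_, ?_, fun _ => ?_⟩ <;> simp only <;> linarith
  have h4 : 0 < u.2 := by
    rcases h2 with h2 | h2
    · exact h2
    · linarith [h2.2]
  rcases le_or_gt (2039 / 100000) u.1 with h5 | h5
  · rw [halfTurn_of_ge h5 h4 h1]
    refine ⟨?_, ?_, ?_, fun _ => ?_⟩ <;> simp only <;> linarith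
  · rw [halfTurn, if_neg (by linarith)]
    obtain ⟨b1, b2, b3, b4⟩ := corner_bounds (u := narrow u) (by rw [e]; simp only; linarith)
      (by rw [e]; simp only; linarith)
    rw [e] at b2 b3 b4
    simp only at b2 b3 b4
    rw [e]
    rw [e] at b1
    refine ⟨?_, ?_, ?_, fun _ => ?_⟩ <;> linarith

theorem halfTurn_fst_lt_iff {u : ℝ × ℝ} (hu : u ∈ halfStrip) :
    (halfTurn u).1 < 201 / 1000 ↔ u.1 < 3 / 1000 := by
  obtain ⟨h0, h1, h2⟩ := hu
  have hr : runX (3 / 1000) = 201 / 1000 := by rw [runX_of_ge (by norm_num)]; norm_num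
  rcases le_or_gt u.1 (1999 / 100000) with h3 | h3
  · rw [halfTurn_of_le h3 h1, ← hr]
    exact strictMono_runX.lt_iff_lt
  · have e := narrow_of_gt (u := u) (by linarith)
    rw [halfTurn, if_neg (by linarith)]
    obtain ⟨b1, -⟩ := corner_bounds (u := narrow u) (by rw [e]; simp only; linarith)
      (by rw [e]; simp only; linarith)
    constructor <;> intro <;> linarith

theorem halfTurn_injOn : Set.InjOn halfTurn halfStrip := by
  intro u hu w hw e
  have hiff : u.1 < 3 / 1000 ↔ w.1 < 3 / 1000 := by
    rw [← halfTurn_fst_lt_iff hu, ← halfTurn_fst_lt_iff hw, e]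
  by_cases h : u.1 < 3 / 1000
  · rw [halfTurn, halfTurn, if_pos h, if_pos (hiff.1 h)] at e
    exact narrow_injective e
  · rw [halfTurn, halfTurn, if_neg h, if_neg (mt hiff.2 h)] at e
    exact narrow_injective (corner_injective e)

/-- The length of the U-turn `uTurn Y`. -/
noncomputable def turnLen (Y : ℝ) : ℝ := (3158 / 1000 + Y) / 100

/-- The domain of `uTurn Y`. -/
def turnStrip (Y : ℝ) : Set (ℝ × ℝ) :=
  {u | (u.1 ≤ turnLen Y / 2 → u ∈ halfStrip) ∧
    (turnLen Y / 2 ≤ u.1 → flipFst (turnLen Y) u ∈ halfStrip)}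

/-- The U-turn of a strip that comes in at height `(0, 1)` and leaves at height `(Y - 1, Y)`. -/
noncomputable def uTurn (Y : ℝ) (u : ℝ × ℝ) : ℝ × ℝ :=
  if u.1 ≤ turnLen Y / 2 then halfTurn u else flipSnd Y (halfTurn (flipFst (turnLen Y) u))

variable {Y : ℝ}

theorem flipFst_mem_turnStrip {u : ℝ × ℝ} (hu : u ∈ turnStrip Y) :
    flipFst (turnLen Y) u ∈ turnStrip Y := by
  refine ⟨fun h => hu.2 ?_, fun h => ?_⟩
  · simp only [flipFst] at h; linarith
  · have h' : u.1 ≤ turnLen Y / 2 := by simp only [flipFst] at h; linarith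
    simpa [flipFst] using hu.1 h'

theorem uTurn_eq_halfTurn (hY : 1 ≤ Y) {u : ℝ × ℝ} (h1 : u.1 < turnLen Y / 2 + 2 / 10000)
    (h2 : u.1 ≤ turnLen Y / 2 ∨ 0 < u.2 ∧ u.2 < 1) : uTurn Y u = halfTurn u := by
  rw [uTurn]
  split_ifs with h
  · rfl
  · obtain ⟨h3, h4⟩ := h2.resolve_left h
    rw [turnLen] at h h1
    rw [halfTurn_of_ge (u := u) (by linarith) h3 h4,
      halfTurn_of_ge (u := flipFst _ u) (by simp only [flipFst, turnLen]; linarith) h3 h4]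
    simp only [flipFst, flipSnd, Prod.mk.injEq, turnLen, true_and]
    ring

theorem uTurn_flipFst (hY : 1 ≤ Y) {u : ℝ × ℝ} (hu : u ∈ turnStrip Y) :
    uTurn Y (flipFst (turnLen Y) u) = flipSnd Y (uTurn Y u) := by
  have hff : flipFst (turnLen Y) (flipFst (turnLen Y) u) = u := by simp [flipFst]
  have hf1 : (flipFst (turnLen Y) u).1 = turnLen Y - u.1 := rfl
  rcases lt_trichotomy u.1 (turnLen Y / 2) with h | h | h
  · rw [uTurn, if_neg (by rw [hf1]; linarith), hff, uTurn, if_pos h.le]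
  · have hfu : flipFst (turnLen Y) u = u := by ext <;> simp only [flipFst]; linarith
    obtain ⟨-, h1, h2⟩ := hu.1 h.le
    have h0 : 0 < u.2 := by
      rcases h2 with h2 | h2
      · exact h2
      · unfold turnLen at h
        linarith [h2.2]
    rw [hfu, uTurn, if_pos h.le, halfTurn_of_ge (by rw [h, turnLen]; linarith) h0 h1]
    simp only [flipSnd, Prod.mk.injEq, true_and, h, turnLen]
    ring
  · rw [uTurn, if_pos (by rw [hf1]; linarith), uTurn, if_neg (by linarith), flipSnd_flipSnd]

theorem areaAt_uTurn (hY : 1 ≤ Y) {u : ℝ × ℝ} (hu : u ∈ turnStrip Y) : AreaAt 1 (uTurn Y) u := by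
  rcases le_or_gt u.1 (turnLen Y / 2) with h | h
  · refine (areaAt_halfTurn (hu.1 h)).congr ?_
    rcases h.lt_or_eq with h' | h'
    · filter_upwards [(isOpen_Iio.preimage continuous_fst).mem_nhds h'] with w hw
      exact uTurn_eq_halfTurn hY (lt_trans hw (by linarith)) (.inl (le_of_lt hw))
    · obtain ⟨-, h1, h2⟩ := hu.1 h
      have h0 : 0 < u.2 := by
        rcases h2 with h2 | h2
        · exact h2
        · unfold turnLen at h'
          linarith [h2.2]
      have h3 : u.1 < turnLen Y / 2 + 2 / 10000 := by linarith
      filter_upwards [(isOpen_Iio.preimage continuous_fst).mem_nhds h3,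
        (isOpen_Ioo.preimage continuous_snd).mem_nhds (show u.2 ∈ Set.Ioo 0 1 from ⟨h0, h1⟩)]
        with w hw1 hw2
      exact uTurn_eq_halfTurn hY hw1 (.inr hw2)
  · have := (areaAt_flipSnd Y _).comp ((areaAt_halfTurn (hu.2 h.le)).comp
      (areaAt_flipFst (turnLen Y) u))
    norm_num at this
    refine this.congr ?_
    filter_upwards [(isOpen_Ioi.preimage continuous_fst).mem_nhds h] with w hw
    exact if_neg (not_le.2 hw)

theorem uTurn_of_lt (hY : 1 ≤ Y) {u : ℝ × ℝ} (h : u.1 < 1 / 1000) : uTurn Y u = u := by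
  rw [uTurn, if_pos (by rw [turnLen]; linarith), halfTurn_of_lt h]

theorem uTurn_of_gt (hY : 1 ≤ Y) {u : ℝ × ℝ} (h : turnLen Y - 1 / 1000 < u.1) :
    uTurn Y u = (turnLen Y - u.1, Y - u.2) := by
  rw [uTurn, if_neg (by rw [turnLen] at *; linarith),
    halfTurn_of_lt (by simp only [flipFst]; linarith)]
  rfl

theorem uTurn_bounds_of_le (hY : 1 ≤ Y) {u : ℝ × ℝ} (hu : u ∈ turnStrip Y) (h : u.1 ≤ 2 / 1000) :
    (uTurn Y u).1 ≤ 101 / 1000 ∧ (0 < u.1 → 0 < (uTurn Y u).1) ∧ 0 < (uTurn Y u).2 ∧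
      (uTurn Y u).2 < 1 := by
  have h' : u.1 ≤ turnLen Y / 2 := by rw [turnLen]; linarith
  obtain ⟨b0, b1, b2, b3⟩ := halfTurn_bounds_of_le (hu.1 h') h
  rw [uTurn, if_pos h']
  refine ⟨b1, fun h0 => ?_, b2, b3⟩
  have := strictMono_runX h0
  rw [runX_of_le (by norm_num)] at this
  rwa [b0]

theorem uTurn_bounds_of_lt_half (hY : 1 ≤ Y) {u : ℝ × ℝ} (hu : u ∈ turnStrip Y)
    (h : 2 / 1000 < u.1) (h' : u.1 < turnLen Y / 2) :
    101 / 1000 < (uTurn Y u).1 ∧ (uTurn Y u).1 < 2 ∧ 0 < (uTurn Y u).2 ∧ (uTurn Y u).2 < Y / 2 := by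
  obtain ⟨b0, b1, b2, b3⟩ := halfTurn_bounds_of_gt (hu.1 h'.le) hY h
  rw [uTurn, if_pos h'.le]
  exact ⟨b0, b1, b2, b3 (by rw [turnLen] at h'; linarith)⟩

theorem uTurn_snd_half (hY : 1 ≤ Y) {u : ℝ × ℝ} (hu : u ∈ turnStrip Y)
    (h : u.1 = turnLen Y / 2) : (uTurn Y u).2 = Y / 2 := by
  have h1 := uTurn_flipFst hY hu
  have hfu : flipFst (turnLen Y) u = u := by ext <;> simp only [flipFst]; linarith
  rw [hfu] at h1
  have := congrArg Prod.snd h1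
  simp only [flipSnd] at this
  linarith

theorem uTurn_bounds_of_ge_half (hY : 1 ≤ Y) {u : ℝ × ℝ} (hu : u ∈ turnStrip Y)
    (h : turnLen Y / 2 ≤ u.1) (h' : u.1 < turnLen Y - 2 / 1000) :
    101 / 1000 < (uTurn Y u).1 ∧ (uTurn Y u).1 < 2 ∧ Y / 2 ≤ (uTurn Y u).2 ∧ (uTurn Y u).2 < Y := by
  rcases h.lt_or_eq with h1 | h1
  · obtain ⟨b0, b1, b2, b3⟩ := uTurn_bounds_of_lt_half hY (flipFst_mem_turnStrip hu)
      (by simp only [flipFst]; linarith) (by simp only [flipFst]; linarith)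
    rw [uTurn_flipFst hY hu] at b0 b1 b2 b3
    simp only [flipSnd] at b0 b1 b2 b3
    refine ⟨b0, b1, ?_, ?_⟩ <;> linarith
  · have e := uTurn_snd_half hY hu h1.symm
    obtain ⟨b0, b1, b2, -⟩ := halfTurn_bounds_of_gt (hu.1 h1.ge) hY
      (by rw [← h1, turnLen]; linarith)
    rw [e]
    rw [uTurn, if_pos h1.ge]
    refine ⟨b0, b1, ?_, ?_⟩ <;> linarith

theorem uTurn_bounds_of_ge (hY : 1 ≤ Y) {u : ℝ × ℝ} (hu : u ∈ turnStrip Y)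
    (h : turnLen Y - 2 / 1000 ≤ u.1) :
    (uTurn Y u).1 ≤ 101 / 1000 ∧ (u.1 < turnLen Y → 0 < (uTurn Y u).1) ∧ Y - 1 < (uTurn Y u).2 ∧
      (uTurn Y u).2 < Y := by
  obtain ⟨b0, b1, b2, b3⟩ := uTurn_bounds_of_le hY (flipFst_mem_turnStrip hu)
    (by simp only [flipFst]; linarith)
  rw [uTurn_flipFst hY hu] at b0 b1 b2 b3
  simp only [flipSnd, flipFst] at b0 b1 b2 b3
  refine ⟨b0, fun h => b1 (by linarith), ?_, ?_⟩ <;> linarith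

theorem uTurn_mem (hY : 1 ≤ Y) {u : ℝ × ℝ} (hu : u ∈ turnStrip Y) (h0 : 0 < u.1)
    (h1 : u.1 < turnLen Y) :
    (0 < (uTurn Y u).1 ∧ (uTurn Y u).1 < 2) ∧ 0 < (uTurn Y u).2 ∧ (uTurn Y u).2 < Y := by
  rcases le_or_gt u.1 (2 / 1000) with h | h
  · obtain ⟨b0, b1, b2, b3⟩ := uTurn_bounds_of_le hY hu h
    exact ⟨⟨b1 h0, by linarith⟩, b2, by linarith⟩
  rcases lt_or_ge u.1 (turnLen Y / 2) with h2 | h2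
  · obtain ⟨b0, b1, b2, b3⟩ := uTurn_bounds_of_lt_half hY hu h h2
    exact ⟨⟨by linarith, b1⟩, b2, by linarith⟩
  rcases lt_or_ge u.1 (turnLen Y - 2 / 1000) with h3 | h3
  · obtain ⟨b0, b1, b2, b3⟩ := uTurn_bounds_of_ge_half hY hu h2 h3
    exact ⟨⟨by linarith, b1⟩, by linarith, b3⟩
  · obtain ⟨b0, b1, b2, b3⟩ := uTurn_bounds_of_ge hY hu h3
    exact ⟨⟨b1 h1, by linarith⟩, by linarith, b3⟩

theorem uTurn_injOn_of_lt (hY : 1 ≤ Y) :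
    Set.InjOn (uTurn Y) {u | u ∈ turnStrip Y ∧ u.1 < turnLen Y - 2 / 1000} := by
  have key : ∀ u w : ℝ × ℝ, u ∈ turnStrip Y → w ∈ turnStrip Y → u.1 < turnLen Y / 2 →
      turnLen Y / 2 ≤ w.1 → w.1 < turnLen Y - 2 / 1000 → uTurn Y u ≠ uTurn Y w := by
    intro u w hu hw h1 h2 h3 e
    obtain ⟨b0, b1, b2, b3⟩ := uTurn_bounds_of_ge_half hY hw h2 h3
    rcases le_or_gt u.1 (2 / 1000) with h | h
    · have := (uTurn_bounds_of_le hY hu h).1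
      rw [e] at this
      linarith
    · have := (uTurn_bounds_of_lt_half hY hu h h1).2.2.2
      rw [e] at this
      linarith
  have hinj : ∀ u w : ℝ × ℝ, u ∈ turnStrip Y → w ∈ turnStrip Y → u.1 ≤ turnLen Y / 2 →
      w.1 ≤ turnLen Y / 2 → uTurn Y u = uTurn Y w → u = w := by
    intro u w hu hw h1 h2 e
    rw [uTurn, uTurn, if_pos h1, if_pos h2] at e
    exact halfTurn_injOn (hu.1 h1) (hw.1 h2) e
  rintro u ⟨hu, hu'⟩ w ⟨hw, hw'⟩ e
  rcases lt_or_ge u.1 (turnLen Y / 2) with h1 | h1 <;>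
    rcases lt_or_ge w.1 (turnLen Y / 2) with h2 | h2
  · exact hinj u w hu hw h1.le h2.le e
  · exact absurd e (key u w hu hw h1 h2 hw')
  · exact absurd e.symm (key w u hw hu h2 h1 hu')
  · have := hinj _ _ (flipFst_mem_turnStrip hu) (flipFst_mem_turnStrip hw)
      (by simp only [flipFst]; linarith) (by simp only [flipFst]; linarith)
      (by rw [uTurn_flipFst hY hu, uTurn_flipFst hY hw, e])
    simp only [flipFst, Prod.mk.injEq] at this
    ext
    · linarith [this.1]
    · exact this.2

/-- Only the two ends of the U-turn can overlap. -/
theorem uTurn_inj (hY : 1 ≤ Y) {u w : ℝ × ℝ} (hu : u ∈ turnStrip Y) (hw : w ∈ turnStrip Y)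
    (e : uTurn Y u = uTurn Y w) :
    u = w ∨ (u.1 ≤ 2 / 1000 ∧ turnLen Y - 2 / 1000 ≤ w.1) ∨
      (w.1 ≤ 2 / 1000 ∧ turnLen Y - 2 / 1000 ≤ u.1) := by
  by_cases h : u.1 < turnLen Y - 2 / 1000 ∧ w.1 < turnLen Y - 2 / 1000
  · exact .inl (uTurn_injOn_of_lt hY ⟨hu, h.1⟩ ⟨hw, h.2⟩ e)
  by_cases h' : 2 / 1000 < u.1 ∧ 2 / 1000 < w.1
  · have := uTurn_injOn_of_lt hY ⟨flipFst_mem_turnStrip hu, by simp only [flipFst]; linarith⟩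
      ⟨flipFst_mem_turnStrip hw, by simp only [flipFst]; linarith⟩
      (by rw [uTurn_flipFst hY hu, uTurn_flipFst hY hw, e])
    simp only [flipFst, Prod.mk.injEq] at this
    left
    ext
    · linarith [this.1]
    · exact this.2
  · have hL : (4 : ℝ) / 1000 < turnLen Y := by rw [turnLen]; linarith
    right
    by_contra hc
    push Not at hc h h'
    rcases le_or_gt u.1 (2 / 1000) with h1 | h1
    · linarith [hc.1 h1, h (by linarith)]
    · have := h' h1
      have := hc.2 this
      linarith [h this]

end UTurn

section Turn

/-- A smooth step function whose slope is at most `31` and is supported where `turnStrip 1` has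
room. -/
theorem exists_foldProfile : ∃ b : ℝ → ℝ, ContDiff ℝ ∞ b ∧ (∀ s, 0 ≤ b s ∧ b s ≤ 1) ∧
    (∀ s, s ≤ 2 / 1000 → b s = 0) ∧ (∀ s, turnLen 1 - 2 / 1000 ≤ s → b s = 1) ∧
    (∀ s, 0 ≤ deriv b s ∧ deriv b s ≤ 31) ∧
    ∀ s, deriv b s ≠ 0 → (3 / 1000 ≤ s ∧ s ≤ 199 / 10000) ∨
      (3 / 1000 ≤ turnLen 1 - s ∧ turnLen 1 - s ≤ 199 / 10000) := by
  set L := turnLen 1 with hL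
  have hLv : L = 4158 / 100000 := by rw [hL, turnLen]; norm_num
  let B : ContDiffBump (115 / 10000 : ℝ) := ⟨83 / 10000, 84 / 10000, by norm_num, by norm_num⟩
  set q : ℝ → ℝ := B.normed MeasureTheory.volume with hq
  have hqc : ContDiff ℝ ∞ q := B.contDiff_normed
  have hq0 : ∀ s, 0 ≤ q s := B.nonneg_normed
  have hq1 : ∀ s, q s ≤ 61 := fun s => by
    refine (B.normed_le_div_measure_closedBall_rIn MeasureTheory.volume s).trans ?_
    rw [MeasureTheory.measureReal_def, Real.volume_closedBall,
      ENNReal.toReal_ofReal (by norm_num)]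
    norm_num
  have hqs : Function.support q = Set.Ioo (31 / 10000) (199 / 10000) := by
    rw [hq, B.support_normed_eq, Real.ball_eq_Ioo]
    norm_num
  have hqz : ∀ s, q s ≠ 0 → 31 / 10000 < s ∧ s < 199 / 10000 := fun s hs => by
    have : s ∈ Function.support q := hs
    rwa [hqs] at this
  have hqi : ∫ s, q s = 1 := B.integral_normed
  set r : ℝ → ℝ := fun s => (q s + q (L - s)) / 2 with hr
  have hrc : ContDiff ℝ ∞ r := by rw [hr]; fun_prop
  have hr0 : ∀ s, 0 ≤ r s := fun s => by
    have := hq0 s; have := hq0 (L - s); simp only [hr]; positivity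
  have hrz : ∀ s, r s ≠ 0 → (31 / 10000 < s ∧ s < 199 / 10000) ∨
      (31 / 10000 < L - s ∧ L - s < 199 / 10000) := fun s hs => by
    by_contra hc
    push Not at hc
    refine hs ?_
    have h1 : q s = 0 := by by_contra h; linarith [hqz s h, hc.1 (hqz s h).1]
    have h2 : q (L - s) = 0 := by
      by_contra h; linarith [hqz _ h, hc.2 (hqz _ h).1]
    simp [hr, h1, h2]
  set b : ℝ → ℝ := fun s => ∫ t in (0 : ℝ)..s, r t with hb
  have hbd : ∀ s, HasDerivAt b (r s) s := fun s =>
    intervalIntegral.integral_hasDerivAt_right (hrc.continuous.intervalIntegrable _ _)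
      (hrc.continuous.stronglyMeasurableAtFilter _ _) hrc.continuous.continuousAt
  have hbd' : deriv b = r := funext fun s => (hbd s).deriv
  have hb0 : ∀ s, s ≤ 2 / 1000 → b s = 0 := by
    intro s hs
    refine (intervalIntegral.integral_congr (g := fun _ => 0) fun t ht => ?_).trans (by simp)
    have ht' : t ≤ 2 / 1000 := by
      rcases Set.mem_uIcc.1 ht with h | h <;> linarith [h.1, h.2]
    by_contra h
    rcases hrz t h with h | h <;> linarith [h.1, h.2]
  have hi : MeasureTheory.Integrable q := hqc.continuous.integrable_of_hasCompactSupport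
    B.hasCompactSupport_normed
  have hb1 : ∀ s, L - 2 / 1000 ≤ s → b s = 1 := by
    intro s hs
    have h1 : b s = ∫ t, r t := by
      refine intervalIntegral.integral_eq_integral_of_support_subset fun t ht => ?_
      rcases hrz t ht with h | h
      · exact ⟨by linarith [h.1], by linarith [h.2]⟩
      · exact ⟨by linarith [h.2], by linarith [h.1]⟩
    rw [h1, hr, MeasureTheory.integral_div, MeasureTheory.integral_add hi (hi.comp_sub_left L),
      MeasureTheory.integral_sub_left_eq_self q, hqi]
    norm_num
  have hbm : Monotone b := monotone_of_deriv_nonneg (fun s => (hbd s).differentiableAt)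
    fun s => by rw [hbd']; exact hr0 s
  refine ⟨b, ?_, fun s => ⟨?_, ?_⟩, hb0, hb1, fun s => ⟨?_, ?_⟩, fun s hs => ?_⟩
  · rw [contDiff_infty_iff_deriv, hbd']
    exact ⟨fun s => (hbd s).differentiableAt, hrc⟩
  · rw [← hb0 (min s 0) ((min_le_right _ _).trans (by norm_num))]
    exact hbm (min_le_left _ _)
  · rw [← hb1 (max s L) (le_trans (by linarith) (le_max_right _ _))]
    exact hbm (le_max_left _ _)
  · rw [hbd']; exact hr0 s
  · rw [hbd']
    have hz : q s = 0 ∨ q (L - s) = 0 := by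
      by_contra hc
      push Not at hc
      linarith [(hqz _ hc.1).2, (hqz _ hc.2).2]
    have := hq1 s
    have := hq1 (L - s)
    simp only [hr]
    rcases hz with h | h <;> rw [h] <;> linarith
  · rw [hbd'] at hs
    rcases hrz s hs with h | h
    · exact .inl ⟨by linarith [h.1], h.2.le⟩
    · exact .inr ⟨by linarith [h.1], h.2.le⟩

variable {n : ℕ} [NeZero n]

/-- The map `(x₁, y₁, …) ↦ (a - x₁, c - y₁, …)`. -/
def rotateFirst (a c : ℝ) (z : SymplSpace n) : SymplSpace n :=
  planeLift (fun u => (a - u.1, c - u.2)) z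

/-- `G` bends the tube `ℝ × (0, 1)²ⁿ⁻¹` at distance at most `2` to the right of `x₁ = 0`: it comes
in along the standard tube and goes out, after the length `L`, along the tube shifted by `σ` in the
coordinate with index `p`. -/
structure IsTurn (p : Fin n × Fin 2) (σ L : ℝ) (G : SymplSpace n → SymplSpace n) : Prop where
  pos : 0 < L
  symplAt : ∀ z ∈ box n Set.univ (Set.Ioo 0 1), SymplAt G z
  of_lt : ∀ z, z (0, 0) < 1 / 1000 → G z = z
  of_gt : ∀ z, L - 1 / 1000 < z (0, 0) → G z = rotateFirst L 1 z + Pi.single p σ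
  inj : ∀ z ∈ box n Set.univ (Set.Ioo 0 1), ∀ w ∈ box n Set.univ (Set.Ioo 0 1),
    z (0, 0) < L → w (0, 0) < L → G z = G w → z = w
  fst_mem : ∀ z ∈ box n Set.univ (Set.Ioo 0 1), 0 < z (0, 0) → z (0, 0) < L →
    G z (0, 0) ∈ Set.Ioo 0 2
  mem : ∀ z ∈ box n Set.univ (Set.Ioo 0 1), 0 < z (0, 0) → z (0, 0) < L → ∀ q, q ≠ (0, 0) →
    G z q ∈ Set.Ioo (min 0 ((Pi.single p σ : SymplSpace n) q))
      (1 + max 0 ((Pi.single p σ : SymplSpace n) q))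

theorem idx_one_ne : ((0, 1) : Fin n × Fin 2) ≠ (0, 0) := by simp

theorem isTurn_planeLift {φ : ℝ × ℝ → ℝ × ℝ} {σ L : ℝ} (hL : 0 < L)
    (h1 : ∀ u : ℝ × ℝ, 0 < u.2 → u.2 < 1 → AreaAt 1 φ u) (h2 : ∀ u : ℝ × ℝ, u.1 < 1 / 1000 → φ u = u)
    (h3 : ∀ u : ℝ × ℝ, L - 1 / 1000 < u.1 → φ u = (L - u.1, 1 + σ - u.2))
    (h4 : ∀ u w : ℝ × ℝ, 0 < u.2 → u.2 < 1 → 0 < w.2 → w.2 < 1 → φ u = φ w → u = w)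
    (h5 : ∀ u : ℝ × ℝ, 0 < u.2 → u.2 < 1 → 0 < u.1 → u.1 < L → (φ u).1 ∈ Set.Ioo 0 2 ∧
      (φ u).2 ∈ Set.Ioo (min 0 σ) (1 + max 0 σ)) :
    IsTurn (n := n) (0, 1) σ L (planeLift φ) where
  pos := hL
  symplAt z hz := symplAt_planeLift (h1 _ (hz.2 _ idx_one_ne).1 (hz.2 _ idx_one_ne).2)
  of_lt z hz := by
    funext q
    by_cases hq0 : q = (0, 0)
    · subst hq0; simp [h2 (z (0, 0), z (0, 1)) hz]
    by_cases hq1 : q = (0, 1)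
    · subst hq1; simp [h2 (z (0, 0), z (0, 1)) hz]
    exact planeLift_of_ne _ _ hq0 hq1
  of_gt z hz := by
    funext q
    by_cases hq0 : q = (0, 0)
    · subst hq0; simp [h3 (z (0, 0), z (0, 1)) hz, rotateFirst]
    by_cases hq1 : q = (0, 1)
    · subst hq1; simp [h3 (z (0, 0), z (0, 1)) hz, rotateFirst]; ring
    simp [rotateFirst, planeLift_of_ne _ _ hq0 hq1, hq1]
  inj z hz w hw _ _ e := by
    have := h4 (z (0, 0), z (0, 1)) (w (0, 0), w (0, 1)) (hz.2 _ idx_one_ne).1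
      (hz.2 _ idx_one_ne).2 (hw.2 _ idx_one_ne).1 (hw.2 _ idx_one_ne).2
      (Prod.ext (by simpa using congrFun e (0, 0)) (by simpa using congrFun e (0, 1)))
    funext q
    by_cases hq0 : q = (0, 0)
    · subst hq0; exact congrArg Prod.fst this
    by_cases hq1 : q = (0, 1)
    · subst hq1; exact congrArg Prod.snd this
    have := congrFun e q
    rwa [planeLift_of_ne _ _ hq0 hq1, planeLift_of_ne _ _ hq0 hq1] at this
  fst_mem z hz h0 hl := by
    rw [planeLift_fst]
    exact (h5 (z (0, 0), z (0, 1)) (hz.2 _ idx_one_ne).1 (hz.2 _ idx_one_ne).2 h0 hl).1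
  mem z hz h0 hl q hq0 := by
    by_cases hq1 : q = (0, 1)
    · subst hq1
      rw [planeLift_snd, Pi.single_eq_same]
      exact (h5 (z (0, 0), z (0, 1)) (hz.2 _ idx_one_ne).1 (hz.2 _ idx_one_ne).2 h0 hl).2
    · rw [planeLift_of_ne _ _ hq0 hq1, Pi.single_eq_of_ne hq1]
      simpa using hz.2 q hq0

theorem mem_turnStrip {Y : ℝ} {u : ℝ × ℝ} (h0 : 0 < u.2) (h1 : u.2 < 1) : u ∈ turnStrip Y :=
  ⟨fun _ => ⟨by linarith, h1, .inl h0⟩,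
    fun _ => ⟨by simp only [flipFst]; linarith, h1, .inl h0⟩⟩

theorem uTurn_two_inj {u w : ℝ × ℝ} (hu0 : 0 < u.2) (hu1 : u.2 < 1) (hw0 : 0 < w.2)
    (hw1 : w.2 < 1) (e : uTurn 2 u = uTurn 2 w) : u = w := by
  have hu := mem_turnStrip (Y := 2) hu0 hu1
  have hw := mem_turnStrip (Y := 2) hw0 hw1
  have h12 : (1 : ℝ) ≤ 2 := by norm_num
  rcases uTurn_inj h12 hu hw e with h | h | h
  · exact h
  · have h1 := (uTurn_bounds_of_le h12 hu h.1).2.2.2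
    have h2 := (uTurn_bounds_of_ge h12 hw h.2).2.2.1
    rw [e] at h1
    linarith
  · have h1 := (uTurn_bounds_of_le h12 hw h.1).2.2.2
    have h2 := (uTurn_bounds_of_ge h12 hu h.2).2.2.1
    rw [e] at h2
    linarith

theorem isTurn_up : IsTurn (n := n) (0, 1) 1 (turnLen 2) (planeLift (uTurn 2)) := by
  have h12 : (1 : ℝ) ≤ 2 := by norm_num
  refine isTurn_planeLift (by rw [turnLen]; norm_num)
    (fun u h0 h1 => areaAt_uTurn h12 (mem_turnStrip h0 h1)) (fun u hu => uTurn_of_lt h12 hu)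
    (fun u hu => ?_) (fun u w hu0 hu1 hw0 hw1 e => uTurn_two_inj hu0 hu1 hw0 hw1 e)
    (fun u h0 h1 h2 h3 => ?_)
  · rw [uTurn_of_gt h12 hu]; norm_num
  · obtain ⟨a, b⟩ := uTurn_mem h12 (mem_turnStrip h0 h1) h2 h3
    refine ⟨a, ?_⟩
    norm_num
    exact b

theorem isTurn_down :
    IsTurn (n := n) (0, 1) (-1) (turnLen 2) (planeLift (flipSnd 1 ∘ uTurn 2 ∘ flipSnd 1)) := by
  have h12 : (1 : ℝ) ≤ 2 := by norm_num
  refine isTurn_planeLift (by rw [turnLen]; norm_num)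
    (fun u h0 h1 => ?_) (fun u hu => ?_)
    (fun u hu => ?_) (fun u w hu0 hu1 hw0 hw1 e => ?_)
    (fun u h0 h1 h2 h3 => ?_)
  · have := (areaAt_flipSnd 1 _).comp ((areaAt_uTurn h12 (mem_turnStrip (Y := 2) (u := flipSnd 1 u)
      (by simp only [flipSnd]; linarith) (by simp only [flipSnd]; linarith))).comp
      (areaAt_flipSnd 1 u))
    norm_num at this
    exact this
  · rw [Function.comp_apply, Function.comp_apply, uTurn_of_lt h12 (u := flipSnd 1 u) hu, flipSnd_flipSnd]
  · rw [Function.comp_apply, Function.comp_apply, uTurn_of_gt h12 (u := flipSnd 1 u) hu]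
    simp only [flipSnd, Prod.mk.injEq, true_and]
    ring
  · have e' := congrArg (flipSnd 1) e
    simp only [Function.comp_apply, flipSnd_flipSnd] at e'
    have := uTurn_two_inj (by simp only [flipSnd]; linarith) (by simp only [flipSnd]; linarith)
      (by simp only [flipSnd]; linarith) (by simp only [flipSnd]; linarith) e'
    simpa using congrArg (flipSnd 1) this
  · obtain ⟨a, b⟩ := uTurn_mem h12 (mem_turnStrip (Y := 2) (u := flipSnd 1 u)
      (by simp only [flipSnd]; linarith) (by simp only [flipSnd]; linarith)) h2 h3
    refine ⟨a, ?_⟩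
    norm_num
    simp only [flipSnd] at b ⊢
    constructor <;> linarith [b.1, b.2]

theorem isTurn_fold {p : Fin n × Fin 2} (hp : p.1 ≠ 0) {σ : ℝ} (hσ : σ = 1 ∨ σ = -1) :
    ∃ G : SymplSpace n → SymplSpace n, IsTurn p σ (turnLen 1) G := by
  obtain ⟨b, hbc, hb01, hb0, hb1, hbd, hbs⟩ := exists_foldProfile
  obtain ⟨c, hc⟩ : ∃ c : ℝ, ∀ t ∈ Set.Ioo (0 : ℝ) 1,
      0 < σ * idxSign p * t + c ∧ σ * idxSign p * t + c < 1 := by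
    have : σ * idxSign p = 1 ∨ σ * idxSign p = -1 := by
      rcases hσ with rfl | rfl <;> unfold idxSign <;> split_ifs <;> norm_num
    rcases this with h | h
    · exact ⟨0, fun t ht => by rw [h]; constructor <;> linarith [ht.1, ht.2]⟩
    · exact ⟨1, fun t ht => by rw [h]; constructor <;> linarith [ht.1, ht.2]⟩
  have hp0 : p ≠ (0, 0) := fun h => hp (congrArg Prod.fst h)
  have hp1 : p ≠ (0, 1) := fun h => hp (congrArg Prod.fst h)
  have hcp : conjIdx p ≠ p := by
    obtain ⟨j, i⟩ := p
    fin_cases i <;> simp [conjIdx]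
  have hcp0 : conjIdx p ≠ (0, 0) := conjIdx_ne hp
  have hcp1 : conjIdx p ≠ (0, 1) := conjIdx_ne hp
  set S : SymplSpace n → SymplSpace n := foldShear b p σ c with hS
  have S0 : ∀ z, S z (0, 0) = z (0, 0) := fun z => by
    simp [hS, foldShear, hp0.symm]
  have S1 : ∀ z, S z (0, 1) = z (0, 1) -
      deriv b (z (0, 0)) * (σ * idxSign p * z (conjIdx p) + c) := fun z => by
    simp [hS, foldShear, hp1.symm]
  have Sp : ∀ z, S z p = z p + σ * b (z (0, 0)) := fun z => by
    simp [hS, foldShear, hp1]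
  have Sq : ∀ z q, q ≠ (0, 1) → q ≠ p → S z q = z q := fun z q h1 h2 => by
    simp [hS, foldShear, h1, h2]
  have hstrip : ∀ z ∈ box n Set.univ (Set.Ioo 0 1), (S z (0, 0), S z (0, 1)) ∈ turnStrip 1 := by
    intro z hz
    obtain ⟨w0, w1⟩ := hc _ (hz.2 _ hcp0)
    obtain ⟨y0, y1⟩ := hz.2 _ idx_one_ne
    obtain ⟨d0, d1⟩ := hbd (z (0, 0))
    rw [S0, S1]
    set w := σ * idxSign p * z (conjIdx p) + c
    have k0 : 0 ≤ deriv b (z (0, 0)) * w := mul_nonneg d0 w0.le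
    have k1 : deriv b (z (0, 0)) * w ≤ 31 := by nlinarith
    by_cases hd : deriv b (z (0, 0)) = 0
    · rw [hd]
      exact mem_turnStrip (by simpa using y0) (by simpa using y1)
    have hL : turnLen 1 = 4158 / 100000 := by rw [turnLen]; norm_num
    refine ⟨fun h => ⟨by simp only; linarith, by simp only; linarith, .inr ?_⟩,
      fun h => ⟨by simp only [flipFst]; linarith, by simp only [flipFst]; linarith, .inr ?_⟩⟩
    · rcases hbs _ hd with h' | h'
      · exact h'
      · simp only at h
        linarith [h'.2]
    · rcases hbs _ hd with h' | h'
      · simp only at h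
        linarith [h'.2]
      · exact h'
  have h11 : (1 : ℝ) ≤ 1 := le_rfl
  have hS_of : ∀ z, deriv b (z (0, 0)) = 0 → S z (0, 1) = z (0, 1) := fun z hz => by
    rw [S1, hz]; ring
  have hL : turnLen 1 = 4158 / 100000 := by rw [turnLen]; norm_num
  refine ⟨planeLift (uTurn 1) ∘ S, ⟨by rw [hL]; norm_num, fun z hz => ?_, fun z hz => ?_,
    fun z hz => ?_, fun z hz w hw hzL hwL e => ?_, fun z hz h0 hl => ?_, fun z hz h0 hl q hq0 => ?_⟩⟩
  · exact SymplAt.comp' (symplAt_planeLift (areaAt_uTurn h11 (hstrip z hz)))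
      (symplAt_foldShear hbc hp σ c z)
  · have hd : deriv b (z (0, 0)) = 0 := by
      by_contra h
      rcases hbs _ h with h' | h' <;> linarith [h'.1, h'.2]
    have hSz : S z = z := by
      funext q
      by_cases h1 : q = (0, 1)
      · rw [h1, hS_of z hd]
      by_cases h2 : q = p
      · rw [h2, Sp, hb0 _ (by linarith)]; ring
      · exact Sq z q h1 h2
    rw [Function.comp_apply, hSz]
    funext q
    by_cases hq0 : q = (0, 0)
    · subst hq0; simp [uTurn_of_lt h11 (u := (z (0, 0), z (0, 1))) hz]
    by_cases hq1 : q = (0, 1)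
    · subst hq1; simp [uTurn_of_lt h11 (u := (z (0, 0), z (0, 1))) hz]
    exact planeLift_of_ne _ _ hq0 hq1
  · have hd : deriv b (z (0, 0)) = 0 := by
      by_contra h
      rcases hbs _ h with h' | h' <;> linarith [h'.1, h'.2]
    have hu := uTurn_of_gt h11 (u := (z (0, 0), z (0, 1))) hz
    rw [Function.comp_apply]
    funext q
    by_cases hq0 : q = (0, 0)
    · subst hq0; simp [rotateFirst, S0, hS_of z hd, hu, hp0.symm]
    by_cases hq1 : q = (0, 1)
    · subst hq1; simp [rotateFirst, S0, hS_of z hd, hu, hp1.symm]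
    rw [planeLift_of_ne _ _ hq0 hq1, Pi.add_apply, rotateFirst, planeLift_of_ne _ _ hq0 hq1]
    by_cases h2 : q = p
    · rw [h2, Sp, hb1 _ (by linarith), Pi.single_eq_same]; ring
    · rw [Sq z q hq1 h2, Pi.single_eq_of_ne h2, add_zero]
  · simp only [Function.comp_apply] at e
    have e2 : ∀ q, q ≠ (0, 0) → q ≠ (0, 1) → S z q = S w q := fun q h0 h1 => by
      have := congrFun e q
      rwa [planeLift_of_ne _ _ h0 h1, planeLift_of_ne _ _ h0 h1] at this
    have e3 := e2 p hp0 hp1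
    rw [Sp, Sp] at e3
    have ez := hz.2 p hp0
    have ew := hw.2 p hp0
    have heq : (S z (0, 0), S z (0, 1)) = (S w (0, 0), S w (0, 1)) := by
      rcases uTurn_inj h11 (hstrip z hz) (hstrip w hw)
        (Prod.ext (by simpa using congrFun e (0, 0)) (by simpa using congrFun e (0, 1)))
        with h | h | h
      · exact h
      · simp only [S0] at h
        rw [hb0 _ h.1, hb1 _ h.2] at e3
        rcases hσ with rfl | rfl <;> linarith [ez.1, ez.2, ew.1, ew.2]
      · simp only [S0] at h
        rw [hb0 _ h.1, hb1 _ h.2] at e3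
        rcases hσ with rfl | rfl <;> linarith [ez.1, ez.2, ew.1, ew.2]
    have e00 : z (0, 0) = w (0, 0) := by simpa [S0] using congrArg Prod.fst heq
    have ecp : z (conjIdx p) = w (conjIdx p) := by
      have := e2 _ hcp0 hcp1
      rwa [Sq _ _ hcp1 hcp, Sq _ _ hcp1 hcp] at this
    funext q
    by_cases hq0 : q = (0, 0)
    · rw [hq0, e00]
    by_cases hq1 : q = (0, 1)
    · have := congrArg Prod.snd heq
      simp only [S1, e00, ecp] at this
      rw [hq1]; linarith
    by_cases h2 : q = p
    · rw [e00] at e3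
      rw [h2]; linarith
    · have := e2 q hq0 hq1
      rwa [Sq _ _ hq1 h2, Sq _ _ hq1 h2] at this
  · rw [Function.comp_apply, planeLift_fst]
    exact (uTurn_mem h11 (hstrip z hz) (by rwa [S0]) (by rwa [S0])).1
  · rw [Function.comp_apply]
    by_cases hq1 : q = (0, 1)
    · subst hq1
      rw [planeLift_snd, Pi.single_eq_of_ne hp1.symm]
      simpa using (uTurn_mem h11 (hstrip z hz) (by rwa [S0]) (by rwa [S0])).2
    rw [planeLift_of_ne _ _ hq0 hq1]
    have hzq := hz.2 q hq0
    by_cases h2 : q = p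
    · subst h2
      rw [Sp, Pi.single_eq_same]
      obtain ⟨b0, b1⟩ := hb01 (z (0, 0))
      rcases hσ with rfl | rfl <;> norm_num <;> constructor <;> linarith [hzq.1, hzq.2]
    · rw [Sq z q hq1 h2, Pi.single_eq_of_ne h2]
      simpa using hzq

theorem exists_isTurn {p : Fin n × Fin 2} (hp : p ≠ (0, 0)) {σ : ℝ} (hσ : σ = 1 ∨ σ = -1) :
    ∃ L : ℝ, ∃ G : SymplSpace n → SymplSpace n, IsTurn p σ L G := by
  by_cases h : p.1 = 0
  · have hp1 : p = (0, 1) := by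
      obtain ⟨j, i⟩ := p
      obtain rfl : j = 0 := h
      fin_cases i
      · exact absurd rfl hp
      · rfl
    subst hp1
    rcases hσ with rfl | rfl
    · exact ⟨_, _, isTurn_up⟩
    · exact ⟨_, _, isTurn_down⟩
  · obtain ⟨G, hG⟩ := isTurn_fold h hσ
    exact ⟨_, G, hG⟩

end Turn

section GridPath

/-- A Hamiltonian path through a grid of odd side length `k`, from one corner to the opposite. -/
theorem exists_gridPath {ι : Type*} [DecidableEq ι] {k : ℕ} (hk : Odd k) (S : Finset ι) :
    ∃ M : ℕ, Odd M ∧ ∃ m : ℕ → ι → ℤ, m 0 = 0 ∧ (∀ q ∈ S, m (M - 1) q = k - 1) ∧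
      (∀ i < M, ∀ q, q ∉ S → m i q = 0) ∧ (∀ i < M, ∀ q, 0 ≤ m i q ∧ m i q < k) ∧
      (∀ i < M, ∀ j < M, m i = m j → i = j) ∧
      (∀ u : ι → ℤ, (∀ q, q ∉ S → u q = 0) → (∀ q, 0 ≤ u q ∧ u q < k) → ∃ i < M, m i = u) ∧
      ∀ i, i + 1 < M → ∃ p ∈ S, ∃ σ : ℤ, (σ = 1 ∨ σ = -1) ∧ m (i + 1) = m i + Pi.single p σ := by
  have hk0 : 0 < k := hk.pos
  induction S using Finset.induction_on with
  | empty =>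
    refine ⟨1, odd_one, fun _ => 0, rfl, by simp, by simp, by simp [hk0], by omega, ?_, by omega⟩
    intro u hu _
    exact ⟨0, one_pos, funext fun q => (hu q (by simp)).symm⟩
  | insert a S ha ih =>
    obtain ⟨M, hM, m, m0, mlast, mout, mrange, minj, msurj, mstep⟩ := ih
    have hM0 : 0 < M := hM.pos
    set g : ℕ → ℕ → ℕ := fun q r => if Even q then r else M - 1 - r with hg
    have hglt : ∀ q r, r < M → g q r < M := fun q r h => by
      simp only [hg]; split_ifs <;> omega
    have hgg : ∀ q r, r < M → g q (g q r) = r := fun q r h => by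
      simp only [hg]; split_ifs <;> omega
    set m' : ℕ → ι → ℤ := fun i => m (g (i / M) (i % M)) + Pi.single a ((i / M : ℕ) : ℤ) with hm'
    have hma : ∀ i, m' i a = (i / M : ℕ) := fun i => by
      simp [hm', mout _ (hglt _ _ (Nat.mod_lt i hM0)) a ha]
    have hmq : ∀ i q, q ≠ a → m' i q = m (g (i / M) (i % M)) q := fun i q hq => by
      simp [hm', hq]
    have hval : ∀ q r, r < M → m' (M * q + r) = m (g q r) + Pi.single a (q : ℤ) := fun q r h => by
      simp only [hm']
      rw [Nat.mul_add_div hM0, Nat.div_eq_of_lt h, add_zero, Nat.mul_add_mod, Nat.mod_eq_of_lt h]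
    have hdecomp : ∀ i, i = M * (i / M) + i % M := fun i => (Nat.div_add_mod i M).symm
    have hdivlt : ∀ i, i < M * k → i / M < k := fun i hi => Nat.div_lt_of_lt_mul hi
    have hlast : M * k - 1 = M * (k - 1) + (M - 1) := by
      obtain ⟨j, rfl⟩ : ∃ j, k = j + 1 := ⟨k - 1, by omega⟩
      rw [Nat.add_sub_cancel, mul_add]; omega
    have hkeven : Even (k - 1) := by
      obtain ⟨j, rfl⟩ := hk
      exact ⟨j, by omega⟩
    refine ⟨M * k, hM.mul hk, m', ?_, ?_, ?_, ?_, ?_, ?_, ?_⟩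
    · simp [hm', hg, m0]
    · intro q hq
      rw [hlast, hval _ _ (by omega)]
      simp only [hg, if_pos hkeven, Pi.add_apply]
      by_cases hqa : q = a
      · subst hqa
        rw [mout _ (by omega) _ ha, Pi.single_eq_same]
        push_cast [Nat.cast_sub hk0]
        ring
      · rw [mlast q (Finset.mem_of_mem_insert_of_ne hq hqa), Pi.single_eq_of_ne hqa, add_zero]
    · intro i _ q hq
      rw [Finset.mem_insert, not_or] at hq
      rw [hmq i q hq.1]
      exact mout _ (hglt _ _ (Nat.mod_lt i hM0)) q hq.2
    · intro i hi q
      by_cases hqa : q = a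
      · subst hqa
        rw [hma]
        exact ⟨by positivity, by exact_mod_cast hdivlt i hi⟩
      · rw [hmq i q hqa]
        exact mrange _ (hglt _ _ (Nat.mod_lt i hM0)) q
    · intro i hi j hj e
      have h1 : i / M = j / M := by
        have := congrFun e a
        rw [hma, hma] at this
        exact_mod_cast this
      have h2 : m (g (i / M) (i % M)) = m (g (j / M) (j % M)) := by
        simp only [hm', h1] at e
        rw [h1]
        exact add_right_cancel e
      have h3 := minj _ (hglt _ _ (Nat.mod_lt i hM0)) _ (hglt _ _ (Nat.mod_lt j hM0)) h2
      rw [h1] at h3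
      have h4 := congrArg (g (j / M)) h3
      rw [hgg _ _ (Nat.mod_lt i hM0), hgg _ _ (Nat.mod_lt j hM0)] at h4
      rw [hdecomp i, hdecomp j, h1, h4]
    · intro u hu hur
      obtain ⟨i, hi, hiu⟩ := msurj (Function.update u a 0) (fun q hq => by
        by_cases hqa : q = a
        · simp [hqa]
        · simpa [hqa] using hu q (by simp [hqa, hq])) (fun q => by
        by_cases hqa : q = a
        · simp [hqa, hk0]
        · simpa [hqa] using hur q)
      obtain ⟨c, hc⟩ : ∃ c : ℕ, (c : ℤ) = u a := ⟨(u a).toNat, Int.toNat_of_nonneg (hur a).1⟩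
      have hck : c < k := by exact_mod_cast hc ▸ (hur a).2
      refine ⟨M * c + g c i, ?_, ?_⟩
      · calc M * c + g c i < M * c + M := by linarith [hglt c i hi]
          _ = M * (c + 1) := by ring
          _ ≤ M * k := Nat.mul_le_mul_left _ hck
      · rw [hval _ _ (hglt c i hi), hgg c i hi, hiu, hc]
        funext q
        by_cases hqa : q = a
        · subst hqa; simp
        · simp [hqa]
    · intro i hi
      have hr := Nat.mod_lt i hM0
      rcases Nat.lt_or_ge (i % M + 1) M with h | h
      · have e1 : m' (i + 1) = m (g (i / M) (i % M + 1)) + Pi.single a ((i / M : ℕ) : ℤ) := by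
          conv_lhs => rw [hdecomp i, add_assoc]
          exact hval _ _ h
        by_cases hq : Even (i / M)
        · obtain ⟨p, hp, σ, hσ, hs⟩ := mstep (i % M) h
          refine ⟨p, Finset.mem_insert_of_mem hp, σ, hσ, ?_⟩
          rw [e1]
          simp only [hm', hg, if_pos hq, hs]
          abel
        · obtain ⟨p, hp, σ, hσ, hs⟩ := mstep (M - 1 - (i % M + 1)) (by omega)
          refine ⟨p, Finset.mem_insert_of_mem hp, -σ, by omega, ?_⟩
          rw [e1]
          rw [show M - 1 - (i % M + 1) + 1 = M - 1 - i % M by omega] at hs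
          simp only [hm', hg, if_neg hq, hs, Pi.single_neg]
          abel
      · have e1 : m' (i + 1) = m (g (i / M + 1) 0) + Pi.single a ((i / M + 1 : ℕ) : ℤ) := by
          have : i + 1 = M * (i / M + 1) + 0 := by
            conv_lhs => rw [hdecomp i]
            rw [mul_add]; omega
          conv_lhs => rw [this]
          exact hval _ _ hM0
        refine ⟨a, Finset.mem_insert_self _ _, 1, .inl rfl, ?_⟩
        have hg' : g (i / M + 1) 0 = g (i / M) (i % M) := by
          have hrM : i % M = M - 1 := by omega
          simp only [hg, hrM, Nat.even_add_one]
          split_ifs <;> omega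
        rw [e1, hg', hm', Nat.cast_add, Pi.single_add, Nat.cast_one, add_assoc]

end GridPath

section Rows

variable {n : ℕ}

theorem symplAt_add_const (a z : SymplSpace n) : SymplAt (fun z => z + a) z :=
  .of_hasFDerivAt (by fun_prop) ((hasFDerivAt_id z).add_const a) fun v w => by simp

variable [NeZero n]

/-- The translation by `a` in the direction of the first coordinate. -/
def slide (a : ℝ) (z : SymplSpace n) : SymplSpace n := z + Pi.single (0, 0) a

@[simp] theorem slide_fst (a : ℝ) (z : SymplSpace n) : slide a z (0, 0) = z (0, 0) + a := by
  simp [slide]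

theorem slide_of_ne (a : ℝ) (z : SymplSpace n) {q : Fin n × Fin 2} (hq : q ≠ (0, 0)) :
    slide a z q = z q := by simp [slide, hq]

theorem slide_slide (a b : ℝ) (z : SymplSpace n) : slide a (slide b z) = slide (b + a) z := by
  simp [slide, Pi.single_add, add_assoc]

theorem slide_zero (z : SymplSpace n) : slide 0 z = z := by simp [slide]

theorem slide_injective (a : ℝ) : Function.Injective (slide (n := n) a) :=
  add_left_injective _

theorem slide_mem_tube {a : ℝ} {z : SymplSpace n} (hz : z ∈ box n Set.univ (Set.Ioo 0 1)) :
    slide a z ∈ box n Set.univ (Set.Ioo 0 1) :=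
  ⟨trivial, fun q hq => by rw [slide_of_ne a z hq]; exact hz.2 q hq⟩

@[simp] theorem rotateFirst_fst (a c : ℝ) (z : SymplSpace n) :
    rotateFirst a c z (0, 0) = a - z (0, 0) := planeLift_fst _ _

@[simp] theorem rotateFirst_snd (a c : ℝ) (z : SymplSpace n) :
    rotateFirst a c z (0, 1) = c - z (0, 1) := planeLift_snd _ _

theorem rotateFirst_of_ne (a c : ℝ) (z : SymplSpace n) {q : Fin n × Fin 2}
    (h0 : q ≠ (0, 0)) (h1 : q ≠ (0, 1)) : rotateFirst a c z q = z q := planeLift_of_ne _ _ h0 h1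

theorem rotateFirst_rotateFirst (a c : ℝ) (z : SymplSpace n) :
    rotateFirst a c (rotateFirst a c z) = z := by
  funext q
  by_cases h0 : q = (0, 0)
  · subst h0; simp
  by_cases h1 : q = (0, 1)
  · subst h1; simp
  rw [rotateFirst_of_ne _ _ _ h0 h1, rotateFirst_of_ne _ _ _ h0 h1]

theorem symplAt_rotateFirst (a c : ℝ) (z : SymplSpace n) : SymplAt (rotateFirst a c) z := by
  refine symplAt_planeLift (φ := fun u => (a - u.1, c - u.2)) ?_
  have := (areaAt_flipSnd c _).comp (areaAt_flipFst a (z (0, 0), z (0, 1)))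
  norm_num at this
  exact this

/-- The direction in which row number `i` is traversed: the even rows are traversed forwards, the
odd ones backwards. -/
def rowDir (k : ℝ) (i : ℕ) (z : SymplSpace n) : SymplSpace n :=
  if Even i then z else rotateFirst k 1 z

theorem rowDir_rowDir (k : ℝ) (i : ℕ) (z : SymplSpace n) : rowDir k i (rowDir k i z) = z := by
  unfold rowDir
  split_ifs
  · rfl
  · exact rotateFirst_rotateFirst _ _ _

theorem rowDir_injective (k : ℝ) (i : ℕ) : Function.Injective (rowDir (n := n) k i) :=
  Function.LeftInverse.injective (rowDir_rowDir k i)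

theorem symplAt_rowDir (k : ℝ) (i : ℕ) (z : SymplSpace n) : SymplAt (rowDir k i) z := by
  by_cases h : Even i
  · have : rowDir (n := n) k i = fun z => z + 0 := by funext z; simp [rowDir, h]
    rw [this]
    exact symplAt_add_const 0 z
  · have : rowDir (n := n) k i = rotateFirst k 1 := by funext z; simp [rowDir, h]
    rw [this]
    exact symplAt_rotateFirst k 1 z

theorem rowDir_succ_fst (k : ℝ) (i : ℕ) (z : SymplSpace n) :
    rowDir k (i + 1) z (0, 0) = k - rowDir k i z (0, 0) := by
  simp only [rowDir, Nat.even_add_one]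
  split_ifs <;> simp

theorem rowDir_fst_congr (k : ℝ) (i : ℕ) {z w : SymplSpace n} (h : z (0, 0) = w (0, 0)) :
    rowDir k i z (0, 0) = rowDir k i w (0, 0) := by
  simp only [rowDir]
  split_ifs <;> simp [h]

theorem rowDir_fst_mem (k : ℝ) (i : ℕ) (z : SymplSpace n) {a : ℝ} :
    rowDir k i z (0, 0) ∈ Set.Ioo a (k - a) ↔ z (0, 0) ∈ Set.Ioo a (k - a) := by
  simp only [rowDir, Set.mem_Ioo]
  split_ifs
  · rfl
  · rw [rotateFirst_fst]
    constructor <;> intro h <;> constructor <;> linarith [h.1, h.2]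

theorem rowDir_mem_tube {k : ℝ} {i : ℕ} {z : SymplSpace n}
    (hz : z ∈ box n Set.univ (Set.Ioo 0 1)) : rowDir k i z ∈ box n Set.univ (Set.Ioo 0 1) := by
  unfold rowDir
  split_ifs
  · exact hz
  refine ⟨trivial, fun q h0 => ?_⟩
  have hq := hz.2 q h0
  by_cases h1 : q = (0, 1)
  · subst h1
    rw [rotateFirst_snd]
    constructor <;> linarith [hq.1, hq.2]
  · rwa [rotateFirst_of_ne _ _ _ h0 h1]

/-- `F` maps the end of row number `i` at position `m`, from `x₁ = k - 2` on if this row runs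
forwards, and a turn of length `L` attached to it. -/
structure IsPiece (k : ℝ) (i : ℕ) (m m' : SymplSpace n) (L δ : ℝ)
    (F : SymplSpace n → SymplSpace n) : Prop where
  length_pos : 0 < L
  pos : 0 < δ
  symplAt : ∀ z ∈ box n Set.univ (Set.Ioo 0 1), SymplAt F z
  of_lt : ∀ z, z (0, 0) < δ → F z = rowDir k i (slide (k - 2) z) + m
  inj : ∀ z ∈ box n Set.univ (Set.Ioo 0 1), ∀ w ∈ box n Set.univ (Set.Ioo 0 1),
    z (0, 0) < L → w (0, 0) < L → F z = F w → z = w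
  fst_mem : ∀ z ∈ box n Set.univ (Set.Ioo 0 1), 0 < z (0, 0) → z (0, 0) < L →
    rowDir k i (F z) (0, 0) ∈ Set.Ioo (k - 2) k
  mem : ∀ z ∈ box n Set.univ (Set.Ioo 0 1), 0 < z (0, 0) → z (0, 0) < L → ∀ q, q ≠ (0, 0) →
    F z q ∈ Set.Ioo (min (m q) (m' q)) (1 + max (m q) (m' q))

theorem exists_isPiece_straight (k : ℝ) (i : ℕ) {m : SymplSpace n} (hm : m (0, 0) = 0) :
    IsPiece k i m m 2 3 fun z => rowDir k i (slide (k - 2) z) + m where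
  length_pos := two_pos
  pos := three_pos
  symplAt z _ := SymplAt.comp' (symplAt_add_const m _)
    (SymplAt.comp' (symplAt_rowDir k i _) (symplAt_add_const _ z))
  of_lt _ _ := rfl
  inj z _ w _ _ _ e := slide_injective _ (rowDir_injective k i (add_right_cancel e))
  fst_mem z _ h0 hl := by
    rw [rowDir_fst_congr (w := rowDir k i (slide (k - 2) z)) _ _ (by simp [hm]), rowDir_rowDir,
      slide_fst]
    constructor <;> linarith
  mem z hz h0 hl q hq := by
    have := (rowDir_mem_tube (k := k) (i := i) (slide_mem_tube (a := k - 2) hz)).2 q hq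
    rw [min_self, max_self, Pi.add_apply]
    constructor <;> linarith [this.1, this.2]

theorem exists_isPiece_turn (k : ℝ) (i : ℕ) {m m' : SymplSpace n} (hm : m (0, 0) = 0)
    {p : Fin n × Fin 2} (hp : p ≠ (0, 0)) {σ : ℝ} (hσ : σ = 1 ∨ σ = -1)
    (hm' : m' = m + Pi.single p σ) :
    ∃ L δ F, IsPiece k i m m' L δ F ∧
      ∀ z, L - 1 / 1000 < z (0, 0) → F z = rowDir k (i + 1) (slide (2 - L) z) + m' := by
  set τ : ℝ := if p = (0, 1) ∧ ¬ Even i then -σ else σ with hτ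
  have hτ1 : τ = 1 ∨ τ = -1 := by
    rw [hτ]; split_ifs
    · rcases hσ with rfl | rfl <;> simp
    · exact hσ
  obtain ⟨L, G, hG⟩ := exists_isTurn hp hτ1
  refine ⟨L, 1 / 1000, fun z => rowDir k i (slide (k - 2) (G z)) + m,
    ⟨hG.pos, by norm_num, fun z hz => ?_, fun z hz => ?_, fun z hz w hw hzL hwL e => ?_,
    fun z hz h0 hl => ?_, fun z hz h0 hl q hq => ?_⟩, fun z hz => ?_⟩
  · exact SymplAt.comp' (symplAt_add_const m _)
      (SymplAt.comp' (symplAt_rowDir k i _) (SymplAt.comp' (symplAt_add_const _ _)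
        (hG.symplAt z hz)))
  · rw [hG.of_lt z hz]
  · exact hG.inj z hz w hw hzL hwL
      (slide_injective _ (rowDir_injective k i (add_right_cancel e)))
  · rw [rowDir_fst_congr (w := rowDir k i (slide (k - 2) (G z))) _ _ (by simp [hm]), rowDir_rowDir,
      slide_fst]
    have := hG.fst_mem z hz h0 hl
    constructor <;> linarith [this.1, this.2]
  · have h := hG.mem z hz h0 hl q hq
    rw [hm', Pi.add_apply, Pi.add_apply, rowDir]
    by_cases hqp : q = p
    · subst hqp
      rw [Pi.single_eq_same] at h ⊢
      split_ifs with hi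
      · rw [slide_of_ne _ _ hq]
        rw [hτ, if_neg (by tauto)] at h
        rcases hσ with rfl | rfl <;> norm_num at h ⊢ <;> constructor <;> linarith
      by_cases hq1 : q = (0, 1)
      · subst hq1
        rw [rotateFirst_snd, slide_of_ne _ _ hq]
        rw [hτ, if_pos ⟨rfl, hi⟩] at h
        rcases hσ with rfl | rfl <;> norm_num at h ⊢ <;> constructor <;> linarith
      · rw [rotateFirst_of_ne _ _ _ hq hq1, slide_of_ne _ _ hq]
        rw [hτ, if_neg (by tauto)] at h
        rcases hσ with rfl | rfl <;> norm_num at h ⊢ <;> constructor <;> linarith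
    · rw [Pi.single_eq_of_ne hqp] at h ⊢
      norm_num at h ⊢
      split_ifs with hi
      · rw [slide_of_ne _ _ hq]
        constructor <;> linarith
      by_cases hq1 : q = (0, 1)
      · subst hq1
        rw [rotateFirst_snd, slide_of_ne _ _ hq]
        constructor <;> linarith
      · rw [rotateFirst_of_ne _ _ _ hq hq1, slide_of_ne _ _ hq]
        constructor <;> linarith
  · simp only [hG.of_gt z hz, hm', rowDir, Nat.even_add_one]
    funext q
    by_cases hq0 : q = (0, 0)
    · subst hq0
      by_cases hi : Even i <;> simp [hi, hp.symm] <;> ring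
    by_cases hq1 : q = (0, 1)
    · subst hq1
      by_cases hpq : p = (0, 1)
      · subst hpq
        by_cases hi : Even i <;> simp [hi, slide_of_ne, hτ] <;> ring
      · have hpq' : ((0, 1) : Fin n × Fin 2) ≠ p := fun h => hpq h.symm
        by_cases hi : Even i <;> simp [hi, slide_of_ne, hpq']
    · by_cases hpq : p = (0, 1)
      · have hqp : q ≠ p := fun h => hq1 (h.trans hpq)
        by_cases hi : Even i <;>
          simp [hi, slide_of_ne, rotateFirst_of_ne, hq0, hq1, hqp]
      · by_cases hqp : q = p
        · subst hqp
          by_cases hi : Even i <;>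
            simp [hi, slide_of_ne, rotateFirst_of_ne, hq0, hq1, hτ] <;> ring
        · by_cases hi : Even i <;>
            simp [hi, slide_of_ne, rotateFirst_of_ne, hq0, hq1, hqp]

end Rows

section Snake

variable {n : ℕ} [NeZero n]

theorem IsPiece.bounds {k : ℝ} (hk : 5 ≤ k) {i : ℕ} {m m' : SymplSpace n} {L δ : ℝ}
    {F : SymplSpace n → SymplSpace n} (hF : IsPiece k i m m' L δ F) (hm : m (0, 0) = 0)
    {z : SymplSpace n} (hz : z ∈ box n Set.univ (Set.Ioo 0 1)) (hzL : z (0, 0) < L) :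
    (∀ q, q ≠ (0, 0) → F z q ∈ Set.Ioo (min (m q) (m' q)) (1 + max (m q) (m' q))) ∧
    min (z (0, 0) + (k - 2)) 2 ≤ rowDir k i (F z) (0, 0) ∧ rowDir k i (F z) (0, 0) < k ∧
    ((∀ q, q ≠ (0, 0) → F z q ∈ Set.Ioo (m q) (1 + m q)) ∨ k - 2 < rowDir k i (F z) (0, 0)) := by
  rcases le_or_gt (z (0, 0)) 0 with h | h
  · have e := hF.of_lt z (h.trans_lt hF.pos)
    have h1 : ∀ q, q ≠ (0, 0) → F z q ∈ Set.Ioo (m q) (1 + m q) := fun q hq => by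
      have := (rowDir_mem_tube (k := k) (i := i) (slide_mem_tube (a := k - 2) hz)).2 q hq
      rw [e, Pi.add_apply]
      constructor <;> linarith [this.1, this.2]
    have h2 : rowDir k i (F z) (0, 0) = z (0, 0) + (k - 2) := by
      rw [e, rowDir_fst_congr (w := rowDir k i (slide (k - 2) z)) _ _ (by simp [hm]),
        rowDir_rowDir, slide_fst]
    refine ⟨fun q hq => ⟨(min_le_left _ _).trans_lt (h1 q hq).1, (h1 q hq).2.trans_le ?_⟩, ?_, ?_,
      .inl h1⟩
    · gcongr; exact le_max_left _ _
    · rw [h2]; exact min_le_left _ _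
    · rw [h2]; linarith
  · obtain ⟨h1, h2⟩ := hF.fst_mem z hz h hzL
    exact ⟨hF.mem z hz h hzL, (min_le_right _ _).trans (by linarith), h2, .inr h1⟩

/-- The map that follows the pieces `F 0, …, F (M - 1)` one after the other; the piece number `i`
starts at time `t i` and uses the time that has passed since `t i + l`. -/
noncomputable def concatPieces (M : ℕ) (t : ℕ → ℝ) (l : ℝ)
    (F : ℕ → SymplSpace n → SymplSpace n) (z : SymplSpace n) : SymplSpace n :=
  F (Nat.findGreatest (fun i => t i ≤ z (0, 0)) (M - 1))
    (slide (-(t (Nat.findGreatest (fun i => t i ≤ z (0, 0)) (M - 1)) + l)) z)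

theorem findGreatest_time {M : ℕ} {t : ℕ → ℝ} (ht : StrictMono t) {i : ℕ} (hi : i < M) {s : ℝ}
    (h0 : i = 0 ∨ t i ≤ s) (h1 : s < t (i + 1)) : Nat.findGreatest (fun i => t i ≤ s) (M - 1) = i := by
  rw [Nat.findGreatest_eq_iff]
  refine ⟨by omega, fun h => h0.resolve_left h, fun j hj _ hj' => ?_⟩
  have := ht.monotone (show i + 1 ≤ j from hj)
  linarith

theorem exists_time {M : ℕ} (hM : 0 < M) {t : ℕ → ℝ} {s : ℝ} (hs : s < t M) :
    ∃ i < M, (i = 0 ∨ t i ≤ s) ∧ s < t (i + 1) := by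
  set i := Nat.findGreatest (fun i => t i ≤ s) (M - 1) with hi
  have hle : i ≤ M - 1 := Nat.findGreatest_le _
  refine ⟨i, by omega, ?_, ?_⟩
  · by_cases h : i = 0
    · exact .inl h
    · exact .inr (Nat.findGreatest_of_ne_zero (P := fun i => t i ≤ s) hi.symm h)
  · by_cases h : i = M - 1
    · rwa [h, Nat.sub_add_cancel hM]
    · exact not_le.1 (Nat.findGreatest_is_greatest (P := fun i => t i ≤ s) (n := M - 1)
        (Nat.lt_succ_self _) (by omega))

variable {k : ℝ} {M : ℕ} {m : ℕ → SymplSpace n} {L δ : ℕ → ℝ} {t : ℕ → ℝ}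
  {F : ℕ → SymplSpace n → SymplSpace n}

theorem concatPieces_of_time (ht : StrictMono t) {l : ℝ} {i : ℕ} (hi : i < M) {z : SymplSpace n}
    (h0 : i = 0 ∨ t i ≤ z (0, 0)) (h1 : z (0, 0) < t (i + 1)) :
    concatPieces M t l F z = F i (slide (-(t i + l)) z) := by
  rw [concatPieces, findGreatest_time ht hi h0 h1]

/-- Each piece describes the concatenation also shortly before its starting time. -/
theorem concatPieces_of_near (hk : 5 ≤ k) (ht : StrictMono t)
    (htL : ∀ i, t (i + 1) = t i + (k - 4) + L i)
    (hF : ∀ i, IsPiece k i (m i) (m (i + 1)) (L i) (δ i) (F i))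
    (hend : ∀ i, i + 1 < M → ∀ z, L i - 1 / 1000 < z (0, 0) →
      F i z = rowDir k (i + 1) (slide (2 - L i) z) + m (i + 1))
    {i : ℕ} (hi : i < M) {z : SymplSpace n} (h0 : i = 0 ∨ t i - 1 / 1000 < z (0, 0))
    (h1 : z (0, 0) < t (i + 1)) :
    concatPieces M t (k - 4) F z = F i (slide (-(t i + (k - 4))) z) := by
  by_cases h : i = 0 ∨ t i ≤ z (0, 0)
  · exact concatPieces_of_time ht hi h h1
  push Not at h
  replace h0 := h0.resolve_left h.1
  obtain ⟨j, rfl⟩ : ∃ j, i = j + 1 := ⟨i - 1, by omega⟩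
  have hj := htL j
  have hLj := (hF j).length_pos
  rw [concatPieces_of_time ht (show j < M by omega) (.inr (by linarith)) h.2,
    hend j hi _ (by rw [slide_fst]; linarith), (hF (j + 1)).of_lt _
      (by rw [slide_fst]; linarith [(hF (j + 1)).pos]), slide_slide, slide_slide]
  congr 3
  linarith

theorem symplAt_concatPieces (hk : 5 ≤ k) (hM : 0 < M) (ht : StrictMono t)
    (htL : ∀ i, t (i + 1) = t i + (k - 4) + L i)
    (hF : ∀ i, IsPiece k i (m i) (m (i + 1)) (L i) (δ i) (F i))
    (hend : ∀ i, i + 1 < M → ∀ z, L i - 1 / 1000 < z (0, 0) →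
      F i z = rowDir k (i + 1) (slide (2 - L i) z) + m (i + 1))
    {z : SymplSpace n} (hz : z ∈ box n Set.univ (Set.Ioo 0 1)) (hzM : z (0, 0) < t M) :
    SymplAt (concatPieces M t (k - 4) F) z := by
  obtain ⟨i, hi, h0, h1⟩ := exists_time hM hzM
  have h : SymplAt (F i ∘ slide (-(t i + (k - 4)))) z :=
    SymplAt.comp' ((hF i).symplAt _ (slide_mem_tube hz)) (symplAt_add_const _ z)
  refine h.congr ?_
  have hc : Continuous fun w : SymplSpace n => w (0, 0) := continuous_apply _
  have hlt : ∀ᶠ w : SymplSpace n in 𝓝 z, w (0, 0) < t (i + 1) :=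
    (isOpen_Iio.preimage hc).mem_nhds h1
  have hgt : ∀ᶠ w : SymplSpace n in 𝓝 z, i = 0 ∨ t i - 1 / 1000 < w (0, 0) := by
    rcases h0 with h0 | h0
    · exact .of_forall fun _ => .inl h0
    · have : ∀ᶠ w : SymplSpace n in 𝓝 z, t i - 1 / 1000 < w (0, 0) :=
        (isOpen_Ioi.preimage hc).mem_nhds (show t i - 1 / 1000 < z (0, 0) by linarith)
      exact this.mono fun _ => .inr
  filter_upwards [hlt, hgt] with w h2 h3
  exact concatPieces_of_near hk ht htL hF hend hi h3 h2

theorem isOpen_box {I J : Set ℝ} (hI : IsOpen I) (hJ : IsOpen J) : IsOpen (box n I J) := by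
  have : box n I J = Set.pi Set.univ fun q => if q = (0, 0) then I else J := by
    ext z
    simp only [box, Set.mem_ofPred_eq, Set.mem_pi, Set.mem_univ, true_imp_iff]
    constructor
    · rintro ⟨h0, h⟩ q
      split_ifs with hq
      · rwa [hq]
      · exact h q hq
    · intro h
      exact ⟨by simpa using h (0, 0), fun q hq => by simpa [hq] using h q⟩
  rw [this]
  refine isOpen_set_pi Set.finite_univ fun q _ => ?_
  split_ifs
  · exact hI
  · exact hJ

end Snake

theorem isOpen_symplCube {n : ℕ} {a : ℝ} : IsOpen (symplCube n a) := by
  have : symplCube n a = Set.pi Set.univ fun _ => Set.Ioo 0 a := by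
    ext z
    simp [symplCube]
  rw [this]
  exact isOpen_set_pi Set.finite_univ fun _ _ => isOpen_Ioo

theorem theorem3p3 (n : ℕ) [NeZero n] (k : ℕ) (hk : 5 ≤ k) (hodd : Odd k) :
    ∃ α : ℝ, 0 < α ∧ ∃ f : SymplSpace n → SymplSpace n,
      IsSymplEmbedding f (box n (Set.Ioo 0 α) (Set.Ioo 0 1)) (symplCube n k) ∧
      -- the image contains the middle slab of the cube without the integer hyperplanes
      box n (Set.Ioo 2 ((k : ℝ) - 2)) (Set.Ioo 0 (k : ℝ)) \ integerHyperplanes n ⊆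
        f '' box n (Set.Ioo 0 α) (Set.Ioo 0 1) ∧
      -- the first and the last unit block lie in the domain
      1 ≤ α ∧
      -- `f` is the identity on the first unit block
      Set.EqOn f id (box n (Set.Ioo 0 1) (Set.Ioo 0 1)) ∧
      -- `f` is the translation by `(k - α, k - 1, …, k - 1)` on the last unit block
      Set.EqOn f (fun z => z + shiftVector n ((k : ℝ) - α) ((k : ℝ) - 1))
        (box n (Set.Ioo (α - 1) α) (Set.Ioo 0 1)) := by
  obtain ⟨M, hModd, m, m0, mlast, mout, mrange, minj, msurj, mstep⟩ :=
    exists_gridPath hodd (Finset.univ.erase ((0, 0) : Fin n × Fin 2))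
  have hM : 0 < M := hModd.pos
  have hK : (5 : ℝ) ≤ k := by exact_mod_cast hk
  set K : ℝ := (k : ℝ) with hKdef
  have hmem : ∀ q : Fin n × Fin 2, q ∈ Finset.univ.erase ((0, 0) : Fin n × Fin 2) ↔ q ≠ (0, 0) := by
    simp
  set r : ℕ → SymplSpace n := fun i q => (m (min i (M - 1)) q : ℝ) with hr
  have hri : ∀ i, i < M → ∀ q, r i q = m i q := fun i hi q => by
    simp only [hr]; rw [min_eq_left (by omega)]
  have hr0 : ∀ i, r i (0, 0) = 0 := fun i => by
    simp only [hr]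
    rw [mout _ (by omega) _ (by simp), Int.cast_zero]
  have hrrange : ∀ i q, 0 ≤ r i q ∧ 1 + r i q ≤ K := fun i q => by
    obtain ⟨a, b⟩ := mrange (min i (M - 1)) (by omega) q
    refine ⟨by simp only [hr]; exact_mod_cast a, ?_⟩
    have : 1 + m (min i (M - 1)) q ≤ k := by omega
    simp only [hr, hKdef]; exact_mod_cast this
  -- consecutive rows
  have hstep : ∀ i, i + 1 < M → ∃ p : Fin n × Fin 2, p ≠ (0, 0) ∧ ∃ σ : ℝ, (σ = 1 ∨ σ = -1) ∧
      r (i + 1) = r i + Pi.single p σ := by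
    intro i hi
    obtain ⟨p, hp, σ, hσ, hs⟩ := mstep i hi
    refine ⟨p, (hmem p).1 hp, σ, ?_, ?_⟩
    · rcases hσ with rfl | rfl <;> simp
    · funext q
      rw [hri _ hi, hs, Pi.add_apply, Pi.add_apply, hri _ (by omega)]
      by_cases hq : q = p
      · subst hq; simp
      · simp [hq]
  have hpieces : ∀ i, ∃ L δ F, IsPiece K i (r i) (r (i + 1)) L δ F ∧ (i + 1 < M →
      ∀ z, L - 1 / 1000 < z (0, 0) → F z = rowDir K (i + 1) (slide (2 - L) z) + r (i + 1)) ∧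
      (M ≤ i + 1 → L = 2 ∧ δ = 3) := by
    intro i
    by_cases hi : i + 1 < M
    · obtain ⟨p, hp, σ, hσ, hs⟩ := hstep i hi
      obtain ⟨L, δ, F, h1, h2⟩ := exists_isPiece_turn K i (hr0 i) hp hσ hs
      exact ⟨L, δ, F, h1, fun _ => h2, fun h => by omega⟩
    · have : r (i + 1) = r i := by
        simp only [hr]; rw [min_eq_right (by omega), min_eq_right (by omega)]
      rw [this]
      exact ⟨_, _, _, exists_isPiece_straight K i (hr0 i), fun h => absurd h hi, fun _ => ⟨rfl, rfl⟩⟩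
  choose L δ F hF hend hstr using hpieces
  set t : ℕ → ℝ := fun i => 2 + ∑ j ∈ Finset.range i, (K - 4 + L j) with htdef
  have htL : ∀ i, t (i + 1) = t i + (K - 4) + L i := fun i => by
    simp only [htdef, Finset.sum_range_succ]; ring
  have ht0 : t 0 = 2 := by simp [htdef]
  have ht : StrictMono t := strictMono_nat_of_lt_succ fun i => by
    rw [htL]; linarith [(hF i).length_pos]
  have ht2 : ∀ i, 2 ≤ t i := fun i => ht0 ▸ ht.monotone (Nat.zero_le i)
  have hlastL : t M = t (M - 1) + (K - 2) := by
    have := htL (M - 1)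
    rw [Nat.sub_add_cancel hM, (hstr (M - 1) (by omega)).1] at this
    rw [this]; ring
  set f := concatPieces M t (K - 4) F with hf
  -- the straight parts
  have hrow : ∀ i, i < M → ∀ z : SymplSpace n, (i = 0 ∨ t i ≤ z (0, 0)) →
      z (0, 0) < t (i + 1) → z (0, 0) < t i + (K - 4) + δ i →
      f z = rowDir K i (slide (2 - t i) z) + r i := by
    intro i hi z h0 h1 h2
    rw [hf, concatPieces_of_time ht hi h0 h1, (hF i).of_lt _ (by rw [slide_fst]; linarith),
      slide_slide]
    congr 3
    ring
  have hcontr : ∀ i, (∀ z ∈ box n (Set.Ioo 0 (t i)) (Set.Ioo 0 1),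
      z ∈ box n Set.univ (Set.Ioo (0 : ℝ) 1)) := fun i z hz => ⟨trivial, hz.2⟩
  -- location of the images
  have hloc : ∀ z ∈ box n (Set.Ioo 0 (t M)) (Set.Ioo 0 1), ∀ i, i < M →
      (i = 0 ∨ t i ≤ z (0, 0)) → z (0, 0) < t (i + 1) →
      (∀ q, q ≠ (0, 0) →
        f z q ∈ Set.Ioo (min (r i q) (r (i + 1) q)) (1 + max (r i q) (r (i + 1) q))) ∧
      0 < rowDir K i (f z) (0, 0) ∧ (i ≠ 0 → 2 ≤ rowDir K i (f z) (0, 0)) ∧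
      rowDir K i (f z) (0, 0) < K ∧ ((∀ q, q ≠ (0, 0) → f z q ∈ Set.Ioo (r i q) (1 + r i q)) ∨
        K - 2 < rowDir K i (f z) (0, 0)) := by
    intro z hz i hi h0 h1
    have e : f z = _ := concatPieces_of_time ht hi h0 h1
    obtain ⟨b1, b2, b3, b4⟩ := (hF i).bounds hK (hr0 i)
      (slide_mem_tube (a := -(t i + (K - 4))) (hcontr M z hz))
      (by rw [slide_fst]; linarith [htL i])
    rw [← e] at b1 b2 b3 b4
    rw [slide_fst] at b2
    refine ⟨b1, lt_of_lt_of_le (lt_min ?_ two_pos) b2, fun hi0 => le_trans (le_min ?_ le_rfl) b2, b3,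
      b4⟩
    · rcases h0 with rfl | h0
      · linarith [hz.1.1]
      · linarith
    · linarith [h0.resolve_left hi0]
  have hfloor : ∀ z ∈ box n (Set.Ioo 0 (t M)) (Set.Ioo 0 1), ∀ i, i < M →
      (i = 0 ∨ t i ≤ z (0, 0)) → z (0, 0) < t (i + 1) →
      (∀ q, q ≠ (0, 0) → ⌊f z q⌋ = m i q) ∨ (i + 1 < M ∧ (∀ q, q ≠ (0, 0) → ⌊f z q⌋ = m (i + 1) q) ∧
        K - 2 < rowDir K i (f z) (0, 0)) := by
    intro z hz i hi h0 h1
    obtain ⟨b1, -, -, -, b4⟩ := hloc z hz i hi h0 h1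
    have hcase : (∀ q, q ≠ (0, 0) → f z q ∈ Set.Ioo (r i q) (1 + r i q)) →
        ∀ q, q ≠ (0, 0) → ⌊f z q⌋ = m i q := fun h q hq => by
      have := h q hq
      rw [hri i hi] at this
      exact Int.floor_eq_iff.2 ⟨this.1.le, by linarith [this.2]⟩
    rcases b4 with b4 | b4
    · exact .inl (hcase b4)
    by_cases hi' : i + 1 < M
    · obtain ⟨p, hp, σ, hσ, hs⟩ := mstep i hi'
      have hb : ∀ q, q ≠ (0, 0) → ⌊f z q⌋ = m i q ∨ ⌊f z q⌋ = m (i + 1) q := fun q hq => by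
        have hbq := b1 q hq
        rw [hri i hi, hri _ hi'] at hbq
        have e : m (i + 1) q = m i q ∨ m (i + 1) q = m i q + 1 ∨ m (i + 1) q = m i q - 1 := by
          rw [hs, Pi.add_apply]
          by_cases hqp : q = p
          · subst hqp
            rw [Pi.single_eq_same]
            omega
          · rw [Pi.single_eq_of_ne hqp]
            omega
        have l1 : min (m i q) (m (i + 1) q) ≤ ⌊f z q⌋ := Int.le_floor.2 (by
          push_cast; exact hbq.1.le)
        have l2 : ⌊f z q⌋ < 1 + max (m i q) (m (i + 1) q) := Int.floor_lt.2 (by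
          push_cast; exact hbq.2)
        omega
      have hne : ∀ q, q ≠ p → m (i + 1) q = m i q := fun q hq => by
        rw [hs, Pi.add_apply, Pi.single_eq_of_ne hq, add_zero]
      have hall : ∀ j, (j = i ∨ j = i + 1) → ⌊f z p⌋ = m j p →
          ∀ q, q ≠ (0, 0) → ⌊f z q⌋ = m j q := by
        intro j hj hjp q hq
        by_cases hqp : q = p
        · rw [hqp, hjp]
        · have := hne q hqp
          rcases hb q hq with h | h <;> rcases hj with rfl | rfl <;> omega
      rcases hb p ((hmem p).1 hp) with h | h
      · exact .inl (hall i (.inl rfl) h)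
      · exact .inr ⟨hi', hall _ (.inr rfl) h, b4⟩
    · refine .inl (hcase fun q hq => ?_)
      have : r (i + 1) = r i := by
        simp only [hr]; rw [min_eq_right (by omega), min_eq_right (by omega)]
      have hbq := b1 q hq
      rwa [this, min_self, max_self] at hbq
  refine ⟨t M, by linarith [ht2 M], f, IsSymplEmbedding.of_symplAt ?_ ?_ ?_ ?_ ?_, ?_,
    by linarith [ht2 M], ?_, ?_⟩
  · exact isOpen_box isOpen_Ioo isOpen_Ioo
  · exact isOpen_symplCube
  · intro z hz
    obtain ⟨i, hi, h0, h1⟩ := exists_time hM hz.1.2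
    obtain ⟨b1, b2, -, b3, -⟩ := hloc z hz i hi h0 h1
    intro q
    by_cases hq : q = (0, 0)
    · subst hq
      have := (rowDir_fst_mem K i (f z) (a := 0)).1 ⟨b2, by linarith⟩
      simpa using this
    · refine ⟨(le_min (hrrange _ _).1 (hrrange _ _).1).trans_lt (b1 q hq).1,
        (b1 q hq).2.trans_le ?_⟩
      rw [← max_add_add_left]
      exact max_le (hrrange _ _).2 (hrrange _ _).2
  · have key : ∀ z ∈ box n (Set.Ioo 0 (t M)) (Set.Ioo 0 1),
        ∀ w ∈ box n (Set.Ioo 0 (t M)) (Set.Ioo 0 1), ∀ i j, i < j → j < M →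
        (i = 0 ∨ t i ≤ z (0, 0)) → z (0, 0) < t (i + 1) →
        (j = 0 ∨ t j ≤ w (0, 0)) → w (0, 0) < t (j + 1) → f z ≠ f w := by
      intro z hz w hw i j hij hj hz0 hz1 hw0 hw1 e
      have hmm : ∀ a b, a < M → b < M → (∀ q, q ≠ (0, 0) → ⌊f z q⌋ = m a q) →
          (∀ q, q ≠ (0, 0) → ⌊f z q⌋ = m b q) → a = b := by
        intro a b ha hb h1 h2
        refine minj a ha b hb (funext fun q => ?_)
        by_cases hq : q = (0, 0)
        · rw [mout a ha q (by simp [hq]), mout b hb q (by simp [hq])]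
        · rw [← h1 q hq, h2 q hq]
      have hjw := (hloc w hw j hj hw0 hw1).2.2.1 (by omega)
      have hfw := hfloor w hw j hj hw0 hw1
      rw [← e] at hjw hfw
      rcases hfloor z hz i (by omega) hz0 hz1 with h1 | ⟨hi, h1, h2⟩
      · rcases hfw with h3 | ⟨hj', h3, -⟩
        · have := hmm _ _ (by omega) hj h1 h3
          omega
        · have := hmm _ _ (by omega) hj' h1 h3
          omega
      · rcases hfw with h3 | ⟨hj', h3, -⟩
        · have := hmm _ _ hi hj h1 h3
          rw [← this, rowDir_succ_fst] at hjw
          linarith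
        · have := hmm _ _ hi hj' h1 h3
          omega
    intro z hz w hw e
    obtain ⟨i, hi, hz0, hz1⟩ := exists_time hM hz.1.2
    obtain ⟨j, hj, hw0, hw1⟩ := exists_time hM hw.1.2
    rcases lt_trichotomy i j with h | h | h
    · exact absurd e (key z hz w hw i j h hj hz0 hz1 hw0 hw1)
    · subst h
      rw [hf, concatPieces_of_time ht hi hz0 hz1, concatPieces_of_time ht hi hw0 hw1] at e
      exact slide_injective _ ((hF i).inj _ (slide_mem_tube (hcontr M z hz)) _
        (slide_mem_tube (hcontr M w hw)) (by rw [slide_fst]; linarith [htL i])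
        (by rw [slide_fst]; linarith [htL i]) e)
    · exact absurd e.symm (key w hw z hz j i h hi hw0 hw1 hz0 hz1)
  · exact fun z hz => symplAt_concatPieces hK hM ht htL hF hend (hcontr M z hz) hz.1.2
  · rintro w ⟨⟨hw0, hw1⟩, hwS⟩
    have hnotint : ∀ q, (⌊w q⌋ : ℝ) < w q := fun q =>
      lt_of_le_of_ne (Int.floor_le _) fun h => hwS ⟨q, _, h.symm⟩
    obtain ⟨i, hi, hmi⟩ := msurj (fun q => if q = (0, 0) then 0 else ⌊w q⌋)
      (fun q hq => by simp at hq; simp [hq]) (fun q => by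
        by_cases hq : q = (0, 0)
        · simp only [hq, if_true]; omega
        · simp only [hq, if_false]
          exact ⟨Int.floor_nonneg.2 (hw1 q hq).1.le, Int.floor_lt.2 (by exact_mod_cast (hw1 q hq).2)⟩)
    have hwr : ∀ q, q ≠ (0, 0) → (w - r i) q ∈ Set.Ioo (0 : ℝ) 1 := fun q hq => by
      have h1 := congrFun hmi q
      simp only [hq, if_false] at h1
      rw [Pi.sub_apply, hri i hi, h1]
      constructor <;> linarith [hnotint q, Int.lt_floor_add_one (w q)]
    set y := rowDir K i (w - r i) with hy
    have hy1 : ∀ q, q ≠ (0, 0) → y q ∈ Set.Ioo (0 : ℝ) 1 :=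
      (rowDir_mem_tube (k := K) (i := i) (show w - r i ∈ box n Set.univ (Set.Ioo 0 1) from
        ⟨trivial, hwr⟩)).2
    have hy0 : y (0, 0) ∈ Set.Ioo 2 (K - 2) := by
      rw [hy, rowDir_fst_mem, Pi.sub_apply, hr0, sub_zero]
      exact hw0
    have hz0 : slide (t i - 2) y (0, 0) = y (0, 0) + (t i - 2) := slide_fst _ _
    have hLi := (hF i).length_pos
    have htM : t (i + 1) ≤ t M := ht.monotone hi
    have := htL i
    refine ⟨slide (t i - 2) y, ⟨⟨?_, ?_⟩, fun q hq => ?_⟩, ?_⟩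
    · rw [hz0]; linarith [ht2 i, hy0.1]
    · rw [hz0]; linarith [hy0.2]
    · rw [slide_of_ne _ _ hq]; exact hy1 q hq
    · rw [hrow i hi _ (.inr (by rw [hz0]; linarith [hy0.1])) (by rw [hz0]; linarith [hy0.2])
        (by rw [hz0]; linarith [hy0.2, (hF i).pos]), slide_slide, sub_add_sub_cancel, sub_self,
        slide_zero, hy, rowDir_rowDir, sub_add_cancel]
  · intro z hz
    rw [hrow 0 hM z (.inl rfl) (by linarith [hz.1.2, ht2 1])
      (by linarith [hz.1.2, (hF 0).pos]), ht0, sub_self, slide_zero, rowDir, if_pos Even.zero]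
    funext q
    simp [hri 0 hM, m0]
  · intro z hz
    have h1 := hz.1.1
    have h2 := hz.1.2
    have hev : Even (M - 1) := by
      obtain ⟨j, rfl⟩ := hModd
      exact ⟨j, by omega⟩
    rw [hrow (M - 1) (by omega) z (.inr (by linarith)) (by rwa [Nat.sub_add_cancel hM])
      (by rw [(hstr (M - 1) (by omega)).2]; linarith), rowDir, if_pos hev]
    funext q
    by_cases hq : q = (0, 0)
    · subst hq
      simp only [Pi.add_apply, slide_fst, hr0, shiftVector, if_true, hlastL]
      ring
    · simp only [Pi.add_apply, slide_of_ne _ _ hq, hri (M - 1) (by omega), shiftVector, hq,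
        if_false, mlast q ((hmem q).2 hq)]
      push_cast
      rfl
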